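/- **Setting.** Let $\Sigma$ be a signature (function names $f$ with finite arities $\mathsf r(f)$), $A$ a set of labels, $\mathcal V$ and $\mathcal M$ disjoint infinite sets of term variables and distribution variables. $T(\Sigma)$ is the set of closed terms and $\Delta(T(\Sigma))$ the set of discrete probability distributions on it. For a relation $\mathsf R$ on $T(\Sigma)$, a set $Q\subseteq T(\Sigma)$ is $\mathsf R$-closed if $t\in Q$ and $t\mathrel{\mathsf R}t'$ imply $t'\in Q$. *Distribution terms* are built from distribution variables $\mu\in\mathcal M$ and symbols $\delta_t$ ($t$ an open term) by $\sum_{i\in I}p_i\,(\prod_{j=1}^{n_i}\theta_{i,j})\circ g_i^{-1}$, where $I$ is countable, $p_i\in(0,1]$, $\sum_i p_i=1$, the $\theta_{i,j}$ are distribution terms, and $g_i:T(\Sigma)^{n_i}\to T(\Sigma)$ is the map $(s_1,\dots,s_{n_i})\mapsto C_i[s_1,\dots,s_{n_i}]$ given by some term $C_i$ with argument places $1,\dots,n_i$. A closed substitution $\rho$ maps $\mathcal V$ to $T(\Sigma)$ and $\mathcal M$ to $\Delta(T(\Sigma))$; under it, a distribution term $\theta$ denotes a distribution $\rho(\theta)$.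 A *PTSS* $P=(\Sigma,A,R)$ has a set $R$ of rules with (possibly infinite) sets of positive premises $t_k\xrightarrow{a_k}\mu_k$, negative premises $t_l\not\xrightarrow{b_l}$ and quantitative premises $\theta_j(W_j)\gtrless_j q_j$ ($W_j\subseteq\mathcal V$, ${\gtrless_j}\in\{>,\ge,<,\le\}$, $q_j\in[0,1]$), and a conclusion $t\xrightarrow{a}\theta$. A closed substitution $\rho$ is *proper* for a rule if $\rho(\theta_j)(\rho(w))>0$ for all $j$ and $w\in W_j$. *Stratification.* $S:T(\Sigma)\times A\times\Delta(T(\Sigma))\to\mathrm{Ord}$ is a stratification of $P$ if for every rule, with conclusion $c$, and every proper closed $\rho$: $S(\rho(t_k\xrightarrow{a_k}\mu_k))\le S(\rho(c))$ for all positive premises, and $S(\rho(t_l),b_l,\pi)<S(\rho(c))$ for all negative premises and all $\pi\in\Delta(T(\Sigma))$. $P$ is *stratifiable* if it has a stratification. The associated transition relation $\to_P$ is built by transfinite recursion on $\beta$: the transitions of stratum $\beta$ are the least set containing each $\rho(c)$ with $S(\rho(c))=\beta$, $c$ the conclusion of a rule and $\rho$ proper for it, such that the instantiated quantitative premises hold,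 the instantiated positive premises are in the set or are already valid transitions of smaller strata, and no $(\rho(t_l),b_l,\pi)$ is a valid transition of a smaller stratum. *Format.* A rule is in $nt\mu f\theta$ format if it has the form $$\frac{\{t_m(\vec z)\xrightarrow{a_m}\mu_m^{\vec z}: m\in M,\vec z\in\mathcal Z\}\cup\{t_n(\vec z)\not\xrightarrow{b_n}: n\in N,\vec z\in\mathcal Z\}\cup\{\theta_l(Y_l)\trianglerighteq_{l,k}p_{l,k}: l\in L,k\in K_l\}}{f(x_1,\dots,x_{\mathsf r(f)})\xrightarrow{a}\theta}$$ with ${\trianglerighteq_{l,k}}\in\{>,\ge\}$ and $Y_l\subseteq\mathcal V$, where: each $Y_l$ is infinite and $|L|<|Y_l|$; $\mathcal Z=D\times\prod_{w\in W}\{w\}$, where $W\subseteq\mathcal V\setminus\bigcup_lY_l$ and $D\subseteq\prod_{l\in L}Y_l$ is a nonempty set of tuples that projects onto every $Y_l$ and in which different tuples differ at every position; the variables of the terms $t_m(\vec z)$ and $t_n(\vec z)$ are components of $\vec z$, and changing $\vec z$ replaces them correspondingly; all $\mu_m^{\vec z}$ are different; for each $m$ at most one $\mu_m^{\vec z}$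 occurs in $\theta$ or in some $\theta_l$; the $Y_l$ are pairwise disjoint and disjoint from $\{x_1,\dots,x_{\mathsf r(f)}\}$; the $x_i$ are different; no $x_i$ and no element of any $Y_{l'}$ occurs in any $\theta_l$; and $\theta$ and each $\theta_l$ contain only finitely many variables. A rule is in $nt\mu x\theta$ format if it satisfies the same conditions with source $x\in\mathcal V$ instead of $f(x_1,\dots,x_{\mathsf r(f)})$, and $\{x\}$ instead of $\{x_1,\dots,x_{\mathsf r(f)}\}$. No well-foundedness of the rules is required. *Bisimilarity* $\sim$ is the union of all bisimulations, i.e. of all symmetric relations $\mathsf R$ on $T(\Sigma)$ such that $t\mathrel{\mathsf R}t'$ and $t\xrightarrow{a}_P\pi$ imply $t'\xrightarrow{a}_P\pi'$ for some $\pi'$ with $\pi(Q)=\pi'(Q)$ for all $\mathsf R$-closed $Q\subseteq T(\Sigma)$. **Statement.** Let $P$ be a PTSS all of whose rules are in $nt\mu f\theta$ or $nt\mu x\theta$ format, and let $S$ be a stratification of $P$. Then bisimilarity $\sim$ on the associated transition relation $\to_P$ is a congruence for all operators of $P$: it is an equivalence relation, and for every function name $f$ and all closed terms $u_i\sim v_i$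 ($1\le i\le\mathsf r(f)$), $f(u_1,\dots,u_{\mathsf r(f)})\sim f(v_1,\dots,v_{\mathsf r(f)})$. -/

import Mathlib

open scoped ENNReal

/-- A signature: function names with their arities. -/
structure Signature where
  F : Type*
  ar : F → ℕ

/-- Terms over the signature `S` with variables in `X`. -/
inductive Term (S : Signature) (X : Type*) where
  | var (x : X) : Term S X
  | app (f : S.F) (ts : Fin (S.ar f) → Term S X) : Term S X

/-- Closed terms. -/
abbrev CTerm (S : Signature) := Term S Empty

namespace Term

variable {S : Signature} {X Y : Type*}

/-- Simultaneous substitution. -/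
def subst (ρ : X → Term S Y) : Term S X → Term S Y
  | var x => ρ x
  | app f ts => app f (fun i => subst ρ (ts i))

/-- The set of variables of a term. -/
def vars : Term S X → Set X
  | var x => {x}
  | app _ ts => {x | ∃ i, x ∈ vars (ts i)}

end Term

/-- The product of finitely many discrete probability distributions. -/
noncomputable def prodPMF {α : Type*} : (n : ℕ) → (Fin n → PMF α) → PMF (Fin n → α)
  | 0, _ => PMF.pure Fin.elim0
  | n + 1, π => (π 0).bind fun a => (prodPMF n (fun i => π i.succ)).map (Fin.cons a)

theorem prodPMF_apply {α : Type*} (n : ℕ) (π : Fin n → PMF α) (t : Fin n → α) :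
    prodPMF n π t = ∏ i, π i (t i) := by
  classical
  induction n with
  | zero => simp [prodPMF, Subsingleton.elim t Fin.elim0]
  | succ n ih =>
    rw [prodPMF, PMF.bind_apply, tsum_eq_single (t 0), Fin.prod_univ_succ, PMF.map_apply,
      tsum_eq_single (Fin.tail t), ih]
    · simp [Fin.tail, Fin.cons_self_tail]
    · intro s hs
      rw [if_neg]
      rintro h
      exact hs (by rw [h, Fin.tail_cons])
    · intro a ha
      rw [PMF.map_apply]
      have : ∀ s : Fin n → α, ¬ t = Fin.cons a s := by
        rintro s h
        exact ha (by rw [h, Fin.cons_zero])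
      simp [this]

/-- The probability `π(Q)` of a set `Q` under a discrete distribution `π`. -/
noncomputable def mass {α : Type*} (π : PMF α) (Q : Set α) : ℝ≥0∞ := ∑' t : Q, π t

/-- Distribution terms with term variables in `V` and distribution variables in `DV`:
distribution variables, instantiable Dirac distributions, and convex combinations
`∑_{i ∈ I} p i • (∏_{j < n i} θ i j) ∘ (g i)⁻¹`. The index set `I` is the support of `p`, so that
all weights are positive (and `I` is an arbitrary non-empty countable set; the data at an index
of weight zero are irrelevant). The map `g i : T(Σ)^(n i) → T(Σ)` is given by a term with `n i`
argument places, and sends closed terms to the closed term obtained by putting them there. -/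
inductive DistTerm (S : Signature) (V DV : Type*) where
  | dvar (μ : DV) : DistTerm S V DV
  | dirac (t : Term S V) : DistTerm S V DV
  | mix (p : PMF ℕ) (n : ℕ → ℕ) (g : (i : ℕ) → Term S (Fin (n i)))
      (θ : (i : ℕ) → Fin (n i) → DistTerm S V DV) : DistTerm S V DV

/-- Closed substitutions: closed terms for term variables, and discrete probability distributions
on closed terms for distribution variables. -/
structure ClosedSubst (S : Signature) (V DV : Type*) where
  onTerm : V → CTerm S
  onDist : DV → PMF (CTerm S)

namespace DistTerm

variable {S : Signature} {V DV : Type*}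

/-- The term variables of a distribution term. -/
def tvars : DistTerm S V DV → Set V
  | dvar _ => ∅
  | dirac t => t.vars
  | mix p _ _ θ => {x | ∃ i ∈ p.support, ∃ j, x ∈ tvars (θ i j)}

/-- The distribution variables of a distribution term. -/
def dvars : DistTerm S V DV → Set DV
  | dvar μ => {μ}
  | dirac _ => ∅
  | mix p _ _ θ => {μ | ∃ i ∈ p.support, ∃ j, μ ∈ dvars (θ i j)}

/-- The probability distribution denoted by a distribution term under a closed substitution. -/
noncomputable def eval (ρ : ClosedSubst S V DV) : DistTerm S V DV → PMF (CTerm S)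
  | dvar μ => ρ.onDist μ
  | dirac t => PMF.pure (t.subst ρ.onTerm)
  | mix p n g θ =>
      p.bind fun i => (prodPMF (n i) (fun j => eval ρ (θ i j))).map fun ts => (g i).subst ts

end DistTerm

/-- The comparison symbols of quantitative premises. -/
inductive Cmp where
  | gt | ge | lt | le

/-- The meaning of a comparison symbol. -/
def Cmp.Holds : Cmp → ℝ≥0∞ → ℝ≥0∞ → Prop
  | gt, x, y => x > y
  | ge, x, y => x ≥ y
  | lt, x, y => x < y
  | le, x, y => x ≤ y

/-- A quantitative premise `θ(W) ⋈ q`, with `q ∈ [0,1]`. -/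
structure QuantPrem (S : Signature) (V DV : Type*) where
  θ : DistTerm S V DV
  W : Set V
  cmp : Cmp
  q : Set.Icc (0 : ℝ) 1

/-- A rule, with sets of positive premises `t -a→ μ`, of negative premises `t -b↛` and of
quantitative premises, and with conclusion `source -label→ target`. -/
structure Rule (S : Signature) (A V DV : Type*) where
  pos : Set (Term S V × A × DV)
  neg : Set (Term S V × A)
  quant : Set (QuantPrem S V DV)
  source : Term S V
  label : A
  target : DistTerm S V DV

/-- A probabilistic transition system specification is given by its set of rules. -/
abbrev PTSS (S : Signature) (A V DV : Type*) := Set (Rule S A V DV)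

/-- The set of all conceivable transitions `t -a→ π`. -/
abbrev PTrn (S : Signature) (A : Type*) := CTerm S × A × PMF (CTerm S)

section Semantics

variable {S : Signature} {A V DV : Type*}

/-- The closed instance of a positive premise. -/
def instPos (ρ : ClosedSubst S V DV) (φ : Term S V × A × DV) : PTrn S A :=
  (φ.1.subst ρ.onTerm, φ.2.1, ρ.onDist φ.2.2)

/-- The closed instance of the conclusion of a rule. -/
noncomputable def instConc (ρ : ClosedSubst S V DV) (r : Rule S A V DV) : PTrn S A :=
  (r.source.subst ρ.onTerm, r.label, r.target.eval ρ)

/-- The closed instance of a quantitative premise holds. -/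
def QuantPrem.Holds (ρ : ClosedSubst S V DV) (φ : QuantPrem S V DV) : Prop :=
  φ.cmp.Holds (mass (φ.θ.eval ρ) (ρ.onTerm '' φ.W)) (ENNReal.ofReal φ.q)

/-- A closed substitution is proper for a rule if it maps every variable in the set of a
quantitative premise into the support of the distribution tested by that premise. -/
def IsProper (ρ : ClosedSubst S V DV) (r : Rule S A V DV) : Prop :=
  ∀ φ ∈ r.quant, ∀ w ∈ φ.W, 0 < φ.θ.eval ρ (ρ.onTerm w)

/-- Stratifications of a PTSS. -/
def IsStratification (P : PTSS S A V DV) (str : PTrn S A → Ordinal) : Prop :=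
  ∀ r ∈ P, ∀ ρ : ClosedSubst S V DV, IsProper ρ r →
    (∀ φ ∈ r.pos, str (instPos ρ φ) ≤ str (instConc ρ r)) ∧
    (∀ φ ∈ r.neg, ∀ π : PMF (CTerm S),
      str (φ.1.subst ρ.onTerm, φ.2, π) < str (instConc ρ r))

/-- One stratum of the transition relation: the transitions of stratum `β` that can be derived
once the set `lower` of valid transitions of all smaller strata is known. Positive premises are
satisfied by a transition in `lower` or by one derived before in stratum `β`, negative premises
are checked against `lower`. -/
inductive InStratum (P : PTSS S A V DV) (str : PTrn S A → Ordinal) (β : Ordinal)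
    (lower : Set (PTrn S A)) : PTrn S A → Prop where
  | intro (r : Rule S A V DV) (hr : r ∈ P) (ρ : ClosedSubst S V DV) (hρ : IsProper ρ r)
      (hβ : str (instConc ρ r) = β)
      (hpos : ∀ φ ∈ r.pos, instPos ρ φ ∉ lower → InStratum P str β lower (instPos ρ φ))
      (hquant : ∀ φ ∈ r.quant, φ.Holds ρ)
      (hneg : ∀ φ ∈ r.neg, ∀ π : PMF (CTerm S), (φ.1.subst ρ.onTerm, φ.2, π) ∉ lower) :
      InStratum P str β lower (instConc ρ r)

/-- The valid transitions of stratum `β`, by transfinite recursion on `β`. -/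
def stratum (P : PTSS S A V DV) (str : PTrn S A → Ordinal) (β : Ordinal) : Set (PTrn S A) :=
  {ψ | InStratum P str β {χ | ∃ γ, ∃ _ : γ < β, χ ∈ stratum P str γ} ψ}
termination_by β

/-- The transition relation associated with a PTSS and a stratification. -/
def transRel (P : PTSS S A V DV) (str : PTrn S A → Ordinal) : Set (PTrn S A) :=
  {ψ | ∃ β, ψ ∈ stratum P str β}

/-- `Q` is closed under the relation `R`. -/
def ClosedUnder {α : Type*} (R : α → α → Prop) (Q : Set α) : Prop :=
  ∀ t ∈ Q, ∀ t', R t t' → t' ∈ Q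

/-- The lifting of a relation on closed terms to distributions. -/
def LiftRel {α : Type*} (R : α → α → Prop) (π π' : PMF α) : Prop :=
  ∀ Q : Set α, ClosedUnder R Q → mass π Q = mass π' Q

/-- Bisimulations on a transition relation. -/
def IsBisimulation (T : Set (PTrn S A)) (R : CTerm S → CTerm S → Prop) : Prop :=
  (∀ t t', R t t' → R t' t) ∧
  ∀ t t', R t t' → ∀ a π, (t, a, π) ∈ T → ∃ π', (t', a, π') ∈ T ∧ LiftRel R π π'

/-- Bisimilarity: the union of all bisimulations. -/
def Bisimilar (T : Set (PTrn S A)) (t t' : CTerm S) : Prop :=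
  ∃ R, IsBisimulation T R ∧ R t t'

/-- A congruence on closed terms: an equivalence relation that is preserved by every operator of
the signature. -/
def IsCongruence (R : CTerm S → CTerm S → Prop) : Prop :=
  Equivalence R ∧ ∀ (f : S.F) (u v : Fin (S.ar f) → CTerm S),
    (∀ i, R (u i) (v i)) → R (Term.app f u) (Term.app f v)

end Semantics

section Format

universe u v

/-- `diag` is a diagonal of the family `Y`: a set of tuples in `∏ l, Y l` that projects onto every
`Y l`, and in which two different tuples differ at every position. (For an empty family it
consists of the empty tuple; otherwise non-emptiness follows as soon as some `Y l` is
non-empty.) -/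
structure IsDiag {L V : Type*} (Y : L → Set V) (diag : Set (L → V)) : Prop where
  nonempty : diag.Nonempty
  mem : ∀ z ∈ diag, ∀ l, z l ∈ Y l
  surj : ∀ l, ∀ y ∈ Y l, ∃ z ∈ diag, z l = y
  inj : ∀ z ∈ diag, ∀ z' ∈ diag, (∃ l, z l = z' l) → z = z'

/-- The ingredients of the premises of a rule in the format. A tuple in `𝒵` consists of a tuple
in `diag` and of the fixed variables in `W`. The terms `t_m`, `t_n` have the components of such
a tuple as their variables: `Sum.inl l` is the component in `Y l`, and `Sum.inr w` is the fixed
component `w`. The index set `N` is given as the set `neg` of the pairs `(t_n, b_n)`, and `K l` as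
the set of pairs consisting of a comparison and a bound. -/
structure PremShape (S : Signature) (A : Type*) (V : Type u) (DV : Type v) where
  L : Type u
  Y : L → Set V
  diag : Set (L → V)
  W : Set V
  M : Type v
  t : M → Term S (L ⊕ W)
  a : M → A
  μ : M → (L → V) → DV
  neg : Set (Term S (L ⊕ W) × A)
  θ : L → DistTerm S V DV
  K : L → Set (Cmp × Set.Icc (0 : ℝ) 1)

variable {S : Signature} {A : Type*} {V : Type u} {DV : Type v}

/-- The instance `t(z)` of a term at a tuple. -/
def PremShape.inst (s : PremShape S A V DV) (t : Term S (s.L ⊕ s.W)) (z : s.L → V) : Term S V :=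
  t.subst (Sum.elim (fun l => Term.var (z l)) (fun w : s.W => Term.var w.1))

/-- The premises of `r` have the shape `s`, and all conditions of the format are met, where `X` is
the set of variables in the source of the conclusion. Distribution terms may be countably infinite
convex combinations, but those used in a rule mention only finitely many variables. -/
structure HasPremShape (r : Rule S A V DV) (X : Set V) (s : PremShape S A V DV) : Prop where
  pos_eq : r.pos = {φ | ∃ m, ∃ z ∈ s.diag, φ = (s.inst (s.t m) z, s.a m, s.μ m z)}
  neg_eq : r.neg = {φ | ∃ n ∈ s.neg, ∃ z ∈ s.diag, φ = (s.inst n.1 z, n.2)}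
  quant_eq : r.quant = {φ | ∃ l, ∃ k ∈ s.K l, φ = ⟨s.θ l, s.Y l, k.1, k.2⟩}
  cmp : ∀ l, ∀ k ∈ s.K l, k.1 = Cmp.gt ∨ k.1 = Cmp.ge
  infinite : ∀ l, (s.Y l).Infinite
  card_lt : ∀ l, Cardinal.mk s.L < Cardinal.mk (s.Y l)
  isDiag : IsDiag s.Y s.diag
  disj_W : ∀ l, Disjoint s.W (s.Y l)
  μ_inj : ∀ m m', ∀ z ∈ s.diag, ∀ z' ∈ s.diag, s.μ m z = s.μ m' z' → m = m' ∧ z = z'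
  μ_unique : ∀ m, ∀ z ∈ s.diag, ∀ z' ∈ s.diag,
    s.μ m z ∈ r.target.dvars ∪ ⋃ l, (s.θ l).dvars →
    s.μ m z' ∈ r.target.dvars ∪ ⋃ l, (s.θ l).dvars → z = z'
  disj_X : ∀ l, Disjoint (s.Y l) X
  disj_Y : ∀ l l', l ≠ l' → Disjoint (s.Y l) (s.Y l')
  disj_θ : ∀ l, Disjoint (s.θ l).tvars (X ∪ ⋃ l', s.Y l')
  finite_target : r.target.tvars.Finite ∧ r.target.dvars.Finite
  finite_θ : ∀ l, (s.θ l).tvars.Finite ∧ (s.θ l).dvars.Finite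

/-- Rules with source `f(x₁, …, xₙ)`, for distinct variables `x₁, …, xₙ`. -/
def IsNtMuF (r : Rule S A V DV) : Prop :=
  ∃ (f : S.F) (x : Fin (S.ar f) → V), Function.Injective x ∧
    r.source = Term.app f (fun i => Term.var (x i)) ∧ ∃ s, HasPremShape r (Set.range x) s

/-- Rules whose source is a variable. -/
def IsNtMuX (r : Rule S A V DV) : Prop :=
  ∃ x : V, r.source = Term.var x ∧ ∃ s, HasPremShape r {x} s

/-- A PTSS all of whose rules are in one of the two formats. -/
def InFormat (P : PTSS S A V DV) : Prop :=
  ∀ r ∈ P, IsNtMuF r ∨ IsNtMuX r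

end Format

/-! A term `w` whose variables are pairs of bisimilar closed terms has a left and a right instance,
and pairs of instances form the closure of bisimilarity under the operators. This closure is shown
to be a bisimulation (`IsStratification.isBisimulation_instances`). Call a term whose left instance
is `s` a marking of `s`. By induction on derivations, every transition is transferred at once along
all markings of its source: each marking yields a distribution on marked terms whose left image is
the given target and whose right image is the target of a transition of the right instance
(`IsTransfer`, `Derivable.exists_isTransfer`). At a single pair this is bisimilarity together with a
coupling of the two targets; at an application a new instance of the last rule is built.

Two difficulties occur in building it (`HasPremShape.exists_transfer`). Without well-foundedness,
the marking of a variable in `Y l` is selected from the support of `θ l`, which may depend on that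
very marking through the positive premises. All selections are therefore made monotone in the
markings. Replacing closed subterms by markings of them can only be repeated finitely often, so the
order of markings is chain complete, and least fixed points exist that are again monotone in the
markings of the source.

Moreover, a closed term tested by a quantitative premise may have many markings in the support, with
different right instances, whereas the fixed point selects just one. To keep all of the mass, `Y l`
must reach every one of these countably many markings. Only few tuples influence the tested
distributions or the target, and the others can be reassigned freely (`HasPremShape.exists_cover`).
A reassigned tuple `z` imitates another tuple `κ z` of the original instance, where the same
premises hold.

Negative premises are handled by transfinite induction on strata, alternating `MatchesUpTo` and
`MatchesBeyond`. The second is needed because the stratification gives no relation between the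
strata of the left and the right instance. -/

/-! ### Least fixed points in chain-complete orders -/

section LeastFixedPoint

/-- A monotone map on a partial order in which every chain has a least upper bound has a least
pre-fixed point, which is a fixed point. -/
theorem exists_fixedPoint_le_of_chain_isLUB {α : Type*} [PartialOrder α]
    (hα : ∀ c : Set α, IsChain (· ≤ ·) c → ∃ x, IsLUB c x) (f : α → α) (hf : Monotone f) :
    ∃ x, f x = x ∧ ∀ y, f y ≤ y → x ≤ y := by
  -- Lying below all pre-fixed points is built into the set, so a maximal element is automatically
  -- the least one.
  obtain ⟨m, hm⟩ := zorn_le₀ {x | x ≤ f x ∧ ∀ y, f y ≤ y → x ≤ y} (by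
    intro c hc hchain
    obtain ⟨x, hx⟩ := hα c hchain
    refine ⟨x, ⟨hx.2 fun z hz => (hc hz).1.trans (hf (hx.1 hz)), fun y hy =>
      hx.2 fun z hz => (hc hz).2 y hy⟩, fun z hz => hx.1 hz⟩)
  have hfm : f m ∈ {x | x ≤ f x ∧ ∀ y, f y ≤ y → x ≤ y} :=
    ⟨hf hm.1.1, fun y hy => (hf (hm.1.2 y hy)).trans hy⟩
  exact ⟨m, (hm.2 hfm hm.1.1).antisymm hm.1.1, hm.1.2⟩

theorem exists_isLUB_pi_of_chain {ι : Type*} {α : ι → Type*} [∀ i, PartialOrder (α i)]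
    (hα : ∀ i, ∀ c : Set (α i), IsChain (· ≤ ·) c → ∃ x, IsLUB c x)
    (c : Set (∀ i, α i)) (hc : IsChain (· ≤ ·) c) : ∃ x, IsLUB c x := by
  have : ∀ i, ∃ x, IsLUB (Function.eval i '' c) x := fun i =>
    hα i _ (by
      rintro _ ⟨a, ha, rfl⟩ _ ⟨b, hb, rfl⟩ -
      exact (hc.total ha hb).imp (fun h => h i) fun h => h i)
  choose x hx using this
  exact ⟨x, isLUB_pi.2 hx⟩

end LeastFixedPoint

/-! ### Marked terms and the refinement order -/

namespace Term

variable {S : Signature} {X Y Z : Type*}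

theorem subst_subst (ρ : X → Term S Y) (σ : Y → Term S Z) (t : Term S X) :
    (t.subst ρ).subst σ = t.subst fun x => (ρ x).subst σ := by
  induction t with
  | var x => rfl
  | app f ts ih => simp only [subst, ih]

theorem subst_congr {ρ σ : X → Term S Y} {t : Term S X} (h : ∀ x ∈ t.vars, ρ x = σ x) :
    t.subst ρ = t.subst σ := by
  induction t with
  | var x => exact h x rfl
  | app f ts ih =>
    simp only [subst]
    congr 1
    funext i
    exact ih i fun x hx => h x ⟨i, hx⟩

/-- A closed term as a term with variables in `X`. -/
def emb (t : CTerm S) : Term S X := t.subst fun e => e.elim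

theorem subst_emb (σ : X → Term S Y) (t : CTerm S) : (emb t).subst σ = emb t := by
  rw [emb, subst_subst]
  exact subst_congr fun x => x.elim

theorem emb_closed (t : CTerm S) : emb t = t := by
  induction t with
  | var x => exact x.elim
  | app f ts ih => exact congrArg (app f) (funext ih)

theorem subst_emb_closed (σ : X → CTerm S) (t : CTerm S) : (emb t).subst σ = t := by
  rw [subst_emb, emb_closed]

/-- The number of occurrences of variables in a term. -/
def occ : Term S X → ℕ
  | var _ => 1
  | app _ ts => ∑ i, occ (ts i)

/-- The number of occurrences of function names in a term. -/
def size : Term S X → ℕ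
  | var _ => 0
  | app _ ts => 1 + ∑ i, size (ts i)

/-- A closed term contains at least one function name, so each occurrence of a variable contributes
to the size of the instance. This bounds the height of the order of markings. -/
theorem occ_le_size_subst (ℓ : X → CTerm S) (t : Term S X) : t.occ ≤ (t.subst ℓ).size := by
  induction t with
  | var x =>
    show 1 ≤ (ℓ x).size
    cases ℓ x with
    | var e => exact e.elim
    | app f ts => simp [size]
  | app f ts ih =>
    simp only [occ, subst, size]
    exact (Finset.sum_le_sum fun i _ => ih i).trans (Nat.le_add_left _ _)

theorem occ_emb (t : CTerm S) : (emb t : Term S X).occ = 0 := by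
  induction t with
  | var x => exact x.elim
  | app f ts ih => exact Finset.sum_eq_zero fun i _ => ih i

theorem eq_emb_of_occ_eq_zero (ℓ : X → CTerm S) {t : Term S X} (h : t.occ = 0) :
    emb (t.subst ℓ) = t := by
  induction t with
  | var x => simp [occ] at h
  | app f ts ih =>
    refine congrArg (app f) (funext fun i => ih i ?_)
    exact (Finset.sum_eq_zero_iff.1 h) i (Finset.mem_univ i)

/-- `Refines ℓ w w'` holds if `w'` arises from `w` by replacing some closed subterms by terms that
evaluate to them under `ℓ`. -/
inductive Refines (ℓ : X → CTerm S) : Term S X → Term S X → Prop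
  | bot (w : Term S X) : Refines ℓ (emb (w.subst ℓ)) w
  | var (x : X) : Refines ℓ (var x) (var x)
  | app (f : S.F) (ws ws' : Fin (S.ar f) → Term S X) (h : ∀ i, Refines ℓ (ws i) (ws' i)) :
      Refines ℓ (app f ws) (app f ws')

namespace Refines

variable {ℓ : X → CTerm S} {w w' w'' : Term S X}

theorem refl (w : Term S X) : Refines ℓ w w := by
  induction w with
  | var x => exact .var x
  | app f ts ih => exact .app f ts ts ih

theorem subst_eq (h : Refines ℓ w w') : w.subst ℓ = w'.subst ℓ := by
  induction h with
  | bot w => exact subst_emb_closed _ _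
  | var x => rfl
  | app f ws ws' h ih => exact congrArg (Term.app f) (funext ih)

theorem occ_le (h : Refines ℓ w w') : w.occ ≤ w'.occ := by
  induction h with
  | bot w => rw [occ_emb]; exact Nat.zero_le _
  | var x => exact le_rfl
  | app f ws ws' h ih => exact Finset.sum_le_sum fun i _ => ih i

/-- A proper refinement introduces a new occurrence of a variable: a replacement without variables
is the closed subterm itself. Hence `occ` is strictly monotone, which gives antisymmetry and finite
height. -/
theorem eq_of_occ_le (h : Refines ℓ w w') (h' : w'.occ ≤ w.occ) : w = w' := by
  induction h with
  | bot w => exact eq_emb_of_occ_eq_zero ℓ (by simpa [occ_emb] using h')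
  | var x => rfl
  | app f ws ws' h ih =>
    refine congrArg (Term.app f) (funext fun i => ih i ?_)
    by_contra! hi
    exact absurd h' (not_le.2 (Finset.sum_lt_sum (fun j _ => (h j).occ_le)
      ⟨i, Finset.mem_univ i, hi⟩))

theorem trans (h : Refines ℓ w w') (h' : Refines ℓ w' w'') : Refines ℓ w w'' := by
  induction h generalizing w'' with
  | bot w => rw [h'.subst_eq]; exact .bot _
  | var x => exact h'
  | app f ws ws' h ih =>
    generalize hv : Term.app f ws' = v at h'
    cases h' with
    -- The middle term has no variables here, so the first refinement is an equality.
    | bot _ =>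
      have : Refines ℓ (Term.app f ws) (Term.app f ws') := .app f ws ws' h
      rw [this.eq_of_occ_le (by rw [hv, occ_emb]; exact Nat.zero_le _), hv]
      exact .bot _
    | var x => cases hv
    | app g vs vs' hvs =>
      cases hv
      exact .app f ws vs' fun i => ih i (hvs i)

theorem subst {V : Type*} {τ τ' : V → Term S X} (h : ∀ v, Refines ℓ (τ v) (τ' v))
    (t : Term S V) : Refines ℓ (t.subst τ) (t.subst τ') := by
  induction t with
  | var x => exact h x
  | app f ts ih => exact .app f _ _ ih

end Refines

end Term

/-- The terms that evaluate to the closed term `s` under `ℓ`. -/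
@[ext]
structure Marking {S : Signature} {X : Type*} (ℓ : X → CTerm S) (s : CTerm S) where
  val : Term S X
  property : val.subst ℓ = s

namespace Marking

variable {S : Signature} {X : Type*} {ℓ : X → CTerm S} {s : CTerm S}

instance : PartialOrder (Marking ℓ s) where
  le w w' := w.1.Refines ℓ w'.1
  le_refl w := .refl w.1
  le_trans _ _ _ h h' := h.trans h'
  le_antisymm _ _ h h' := Marking.ext (h.eq_of_occ_le h'.occ_le)

instance : OrderBot (Marking ℓ s) where
  bot := ⟨Term.emb s, Term.subst_emb_closed _ _⟩
  bot_le w := by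
    obtain ⟨w, rfl⟩ := w
    exact Term.Refines.bot w

/-- The number of occurrences is bounded by the size of `s`, so a nonempty chain has a member with
the most occurrences, and this is its greatest element. -/
theorem exists_isLUB_of_chain (c : Set (Marking ℓ s)) (hc : IsChain (· ≤ ·) c) :
    ∃ x, IsLUB c x := by
  rcases c.eq_empty_or_nonempty with rfl | hne
  · exact ⟨⊥, isLUB_empty⟩
  · have hbdd : BddAbove ((fun w : Marking ℓ s => w.1.occ) '' c) := by
      refine ⟨s.size, ?_⟩
      rintro _ ⟨w, -, rfl⟩
      have := w.1.occ_le_size_subst ℓ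
      rwa [w.2] at this
    obtain ⟨m, hm, hmax⟩ := Nat.sSup_mem (hne.image _) hbdd
    refine ⟨m, IsGreatest.isLUB ⟨hm, fun w hw => ?_⟩⟩
    rcases hc.total hw hm with h | h
    · exact h
    · have hmw : m = w := Marking.ext (Term.Refines.eq_of_occ_le h
        ((le_csSup hbdd ⟨w, hw, rfl⟩).trans hmax.ge))
      exact hmw.ge

/-- Simultaneous least fixed points of monotone maps on families of markings can be chosen
monotonically in a parameter. -/
theorem exists_fixedPoint {V C : Type*} [Preorder C] {ρ : V → CTerm S}
    (F : C → (∀ v, Marking ℓ (ρ v)) → ∀ v, Marking ℓ (ρ v))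
    (hF : ∀ χ χ', χ ≤ χ' → ∀ τ τ', τ ≤ τ' → F χ τ ≤ F χ' τ') :
    ∃ τ : C → ∀ v, Marking ℓ (ρ v), Monotone τ ∧ ∀ χ, F χ (τ χ) = τ χ := by
  have := fun χ => exists_fixedPoint_le_of_chain_isLUB
    (exists_isLUB_pi_of_chain fun v : V => exists_isLUB_of_chain (ℓ := ℓ) (s := ρ v))
    (F χ) fun τ τ' h => hF χ χ le_rfl τ τ' h
  choose τ hfix hleast using this
  exact ⟨τ, fun χ χ' h => hleast χ _ ((hF χ χ' h _ _ le_rfl).trans (hfix χ').le), hfix⟩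

end Marking

/-! ### Discrete distributions and couplings -/

section Distributions

variable {α β : Type*}

theorem mass_eq_toOuterMeasure (π : PMF α) (Q : Set α) : mass π Q = π.toOuterMeasure Q := by
  rw [mass, PMF.toOuterMeasure_apply, tsum_subtype]

theorem mass_map (f : α → β) (π : PMF α) (Q : Set β) : mass (π.map f) Q = mass π (f ⁻¹' Q) := by
  simp only [mass_eq_toOuterMeasure, PMF.toOuterMeasure_map_apply]

theorem mass_mono_of_inter_support {π : PMF α} {Q Q' : Set α} (h : Q ∩ π.support ⊆ Q') :
    mass π Q ≤ mass π Q' := by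
  simp only [mass_eq_toOuterMeasure]
  exact PMF.toOuterMeasure_mono π h

theorem PMF.bind_congr_support {p : PMF α} {f g : α → PMF β} (h : ∀ a ∈ p.support, f a = g a) :
    p.bind f = p.bind g := by
  ext b
  simp only [PMF.bind_apply]
  refine tsum_congr fun a => ?_
  by_cases ha : a ∈ p.support
  · rw [h a ha]
  · rw [(p.apply_eq_zero_iff a).2 ha, zero_mul, zero_mul]

theorem prodPMF_map (f : α → β) (n : ℕ) (π : Fin n → PMF α) :
    (prodPMF n π).map (fun t i => f (t i)) = prodPMF n fun i => (π i).map f := by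
  induction n with
  | zero =>
    simp only [prodPMF, PMF.pure_map]
    congr 1
    exact Subsingleton.elim _ _
  | succ n ih =>
    simp only [prodPMF, PMF.map_bind, PMF.bind_map, PMF.map_comp, ← ih]
    congr 1
    funext a
    simp only [Function.comp_def]
    congr 1
    funext t i
    refine Fin.cases ?_ (fun j => ?_) i <;> simp

theorem mem_support_prodPMF {n : ℕ} {π : Fin n → PMF α} {t : Fin n → α} :
    t ∈ (prodPMF n π).support ↔ ∀ i, t i ∈ (π i).support := by
  simp [PMF.mem_support_iff, prodPMF_apply, Finset.prod_eq_zero_iff]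

/-- Distributions that are related by the lifting of an equivalence relation have a coupling inside
that relation. -/
theorem LiftRel.exists_coupling {R : α → α → Prop} (hR : Equivalence R) {π π' : PMF α}
    (h : LiftRel R π π') :
    ∃ Γ : PMF {x : α × α // R x.1 x.2},
      Γ.map (fun x => x.1.1) = π ∧ Γ.map (fun x => x.1.2) = π' := by
  classical
  have hcl : ∀ a, mass π {b | R a b} = mass π' {b | R a b} := fun a =>
    h _ fun b hb c hc => hR.trans hb hc
  let mk : α → α → {x : α × α // R x.1 x.2} := fun a b =>
    if hab : R a b then ⟨(a, b), hab⟩ else ⟨(a, a), hR.refl a⟩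
  have hmk1 : ∀ a b, (mk a b).1.1 = a := by
    intro a b; by_cases hab : R a b <;> simp [mk, hab]
  have hmk2 : ∀ a b, R a b → (mk a b).1.2 = b := by
    intro a b hab; simp [mk, hab]
  -- The coupling draws `a` from `π` and then `b` from `π'` conditioned on the class of `a`. Where
  -- that class has no mass, which cannot happen on the support of `π`, a diagonal pair is the
  -- default.
  let K : α → PMF {x : α × α // R x.1 x.2} := fun a =>
    if hne : ∃ b ∈ {b | R a b}, b ∈ π'.support then (π'.filter {b | R a b} hne).map (mk a)
    else PMF.pure (mk a a)
  refine ⟨π.bind K, ?_, ?_⟩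
  · rw [PMF.map_bind]
    have : ∀ a, (K a).map (fun x => x.1.1) = PMF.pure a := by
      intro a
      by_cases hne : ∃ b ∈ {b | R a b}, b ∈ π'.support
      · simp only [K, dif_pos hne, PMF.map_comp]
        have : (fun x : {x : α × α // R x.1 x.2} => x.1.1) ∘ mk a = Function.const α a :=
          funext fun b => hmk1 a b
        rw [this, PMF.map_const]
      · simp only [K, dif_neg hne, PMF.pure_map, hmk1]
    simp only [this, PMF.bind_pure]
  · rw [PMF.map_bind]
    have hpos : ∀ a ∈ π.support, ∃ b ∈ {b | R a b}, b ∈ π'.support := by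
      intro a ha
      by_contra! hne
      have h0 : mass π' {b | R a b} = 0 := by
        rw [mass_eq_toOuterMeasure, PMF.toOuterMeasure_apply_eq_zero_iff]
        exact Set.disjoint_left.2 fun b hb hb' => hne b hb' hb
      rw [← hcl, mass_eq_toOuterMeasure, PMF.toOuterMeasure_apply_eq_zero_iff] at h0
      exact Set.disjoint_left.1 h0 ha (hR.refl a)
    have hK : ∀ a ∈ π.support, ∀ b, ((K a).map fun x => x.1.2) b
        = {b | R a b}.indicator π' b * (mass π' {b | R a b})⁻¹ := by
      intro a ha b
      have hne := hpos a ha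
      have : (K a).map (fun x => x.1.2) = π'.filter {b | R a b} hne := by
        simp only [K, dif_pos hne, PMF.map_comp]
        conv_rhs => rw [← PMF.map_id (π'.filter {b | R a b} hne)]
        rw [PMF.map, PMF.map]
        refine PMF.bind_congr_support fun c hc => ?_
        have hc' : R a c := ((PMF.mem_support_filter_iff hne).1 hc).1
        simp [hmk2 a c hc']
      rw [this, PMF.filter_apply, mass, tsum_subtype]
    ext b
    rw [PMF.bind_apply]
    -- Only `a` in the class of `b` contribute, and all of them with the same normalising factor,
    -- which cancels against the total mass of the class.
    have h1 : ∀ a, π a * ((K a).map fun x => x.1.2) b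
        = {a | R b a}.indicator π a * (π' b * (mass π' {c | R b c})⁻¹) := by
      intro a
      by_cases ha : a ∈ π.support
      · rw [hK a ha]
        by_cases hab : R a b
        · have : {c | R a c} = {c | R b c} := Set.ext fun c =>
            ⟨fun hc => hR.trans (hR.symm hab) hc, fun hc => hR.trans hab hc⟩
          rw [this, Set.indicator_of_mem (show b ∈ {c | R b c} from hR.refl b),
            Set.indicator_of_mem (show a ∈ {a | R b a} from hR.symm hab)]
        · rw [Set.indicator_of_notMem (show b ∉ {c | R a c} from hab),
            Set.indicator_of_notMem (show a ∉ {a | R b a} from fun h => hab (hR.symm h))]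
          simp
      · have : π a = 0 := (π.apply_eq_zero_iff a).2 ha
        rw [this, zero_mul, Set.indicator_apply, this, ite_self, zero_mul]
    simp only [h1]
    rw [ENNReal.tsum_mul_right, ← tsum_subtype]
    change mass π {c | R b c} * _ = _
    rw [hcl]
    by_cases hb : π' b = 0
    · rw [hb, zero_mul, mul_zero]
    · have hne0 : mass π' {c | R b c} ≠ 0 := by
        rw [mass_eq_toOuterMeasure, Ne, PMF.toOuterMeasure_apply_eq_zero_iff]
        exact fun hd => Set.disjoint_left.1 hd ((π'.mem_support_iff b).2 hb) (hR.refl b)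
      have htop : mass π' {c | R b c} ≠ ⊤ := by
        rw [mass, tsum_subtype]
        exact PMF.tsum_coe_indicator_ne_top π' _
      rw [mul_comm, mul_assoc, ENNReal.inv_mul_cancel hne0 htop, mul_one]

theorem LiftRel.mono {R R' : α → α → Prop} (hRR : ∀ a b, R a b → R' a b) {π π' : PMF α}
    (h : LiftRel R π π') : LiftRel R' π π' :=
  fun Q hQ => h Q fun t ht t' htt' => hQ t ht t' (hRR t t' htt')

end Distributions

/-! ### Distribution terms evaluated on marked terms -/

namespace DistTerm

variable {S : Signature} {V DV X Y : Type*}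

/-- The distribution on terms with variables in `X` that a distribution term denotes when its
variables are interpreted by terms and distributions on terms with variables in `X`. -/
noncomputable def meval (τ : V → Term S X) (D : DV → PMF (Term S X)) :
    DistTerm S V DV → PMF (Term S X)
  | dvar μ => D μ
  | dirac t => PMF.pure (t.subst τ)
  | mix p n g θ =>
      p.bind fun i => (prodPMF (n i) (fun j => meval τ D (θ i j))).map fun ts => (g i).subst ts

theorem eval_eq_meval (ρ : ClosedSubst S V DV) (θ : DistTerm S V DV) :
    θ.eval ρ = θ.meval ρ.onTerm ρ.onDist := by
  induction θ with
  | dvar μ => rfl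
  | dirac t => rfl
  | mix p n g θ ih => simp only [eval, meval, ih]

theorem meval_map_subst (ℓ : X → Term S Y) (τ : V → Term S X) (D : DV → PMF (Term S X))
    (θ : DistTerm S V DV) :
    (θ.meval τ D).map (Term.subst ℓ)
      = θ.meval (fun v => (τ v).subst ℓ) fun μ => (D μ).map (Term.subst ℓ) := by
  induction θ with
  | dvar μ => rfl
  | dirac t => simp only [meval, PMF.pure_map, Term.subst_subst]
  | mix p n g θ ih =>
    simp only [meval, PMF.map_bind, PMF.map_comp, ← ih, ← prodPMF_map]
    congr 1
    funext i
    congr 1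
    funext ts
    exact Term.subst_subst _ _ _

theorem meval_congr {τ τ' : V → Term S X} {D D' : DV → PMF (Term S X)} {θ : DistTerm S V DV}
    (hτ : ∀ v ∈ θ.tvars, τ v = τ' v) (hD : ∀ μ ∈ θ.dvars, D μ = D' μ) :
    θ.meval τ D = θ.meval τ' D' := by
  induction θ with
  | dvar μ => exact hD μ rfl
  | dirac t => exact congrArg PMF.pure (Term.subst_congr hτ)
  | mix p n g θ ih =>
    refine PMF.bind_congr_support fun i hi => ?_
    congr 2
    funext j
    exact ih i j (fun v hv => hτ v ⟨i, hi, j, hv⟩) fun μ hμ => hD μ ⟨i, hi, j, hμ⟩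

/-- The closed term `s` is obtained from elements of the supports of the components of a convex
combination. -/
def Decomposes (ρ : ClosedSubst S V DV) (p : PMF ℕ) (n : ℕ → ℕ) (g : (i : ℕ) → Term S (Fin (n i)))
    (θ : (i : ℕ) → Fin (n i) → DistTerm S V DV) (s : CTerm S) : Prop :=
  ∃ i, ∃ ts : Fin (n i) → CTerm S,
    i ∈ p.support ∧ (∀ j, ts j ∈ ((θ i j).eval ρ).support) ∧ (g i).subst ts = s

theorem mem_support_eval_mix {ρ : ClosedSubst S V DV} {p : PMF ℕ} {n : ℕ → ℕ}
    {g : (i : ℕ) → Term S (Fin (n i))} {θ : (i : ℕ) → Fin (n i) → DistTerm S V DV} {s : CTerm S} :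
    s ∈ ((mix p n g θ).eval ρ).support ↔ Decomposes ρ p n g θ s := by
  simp only [eval, Decomposes, PMF.mem_support_bind_iff, PMF.mem_support_map_iff,
    mem_support_prodPMF, exists_and_left]

open Classical in
/-- A marking of `s`, obtained from a choice of markings of the elements of the supports of the
distributions denoted by distribution variables. How `s` is put together depends on `ρ` only. -/
noncomputable def select (ρ : ClosedSubst S V DV) (τ : V → Term S X)
    (σ : DV → CTerm S → Term S X) : DistTerm S V DV → CTerm S → Term S X
  | dvar μ => σ μ
  | dirac t => fun s => if s = t.subst ρ.onTerm then t.subst τ else Term.emb s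
  | mix p n g θ => fun s =>
      if h : Decomposes ρ p n g θ s then
        (g h.choose).subst fun j => select ρ τ σ (θ h.choose j) (h.choose_spec.choose j)
      else Term.emb s

variable {ρ : ClosedSubst S V DV} {ℓ : X → CTerm S}

theorem select_subst {τ : V → Term S X} {σ : DV → CTerm S → Term S X}
    (hτ : ∀ v, (τ v).subst ℓ = ρ.onTerm v) (hσ : ∀ μ s, (σ μ s).subst ℓ = s)
    (θ : DistTerm S V DV) (s : CTerm S) : (θ.select ρ τ σ s).subst ℓ = s := by
  induction θ generalizing s with
  | dvar μ => exact hσ μ s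
  | dirac t =>
    simp only [select]
    split_ifs with h
    · rw [Term.subst_subst, h]
      exact Term.subst_congr fun x _ => hτ x
    · exact Term.subst_emb_closed _ _
  | mix p n g θ ih =>
    simp only [select]
    split_ifs with h
    · rw [Term.subst_subst]
      simp only [ih]
      exact h.choose_spec.choose_spec.2.2
    · exact Term.subst_emb_closed _ _

/-- Both sides use the same decomposition of `s`, as it is chosen without reference to markings. -/
theorem select_refines {τ τ' : V → Term S X} {σ σ' : DV → CTerm S → Term S X}
    (hτ : ∀ v, (τ v).Refines ℓ (τ' v)) (hσ : ∀ μ s, (σ μ s).Refines ℓ (σ' μ s))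
    (θ : DistTerm S V DV) (s : CTerm S) :
    (θ.select ρ τ σ s).Refines ℓ (θ.select ρ τ' σ' s) := by
  induction θ generalizing s with
  | dvar μ => exact hσ μ s
  | dirac t =>
    simp only [select]
    split_ifs with h
    · exact Term.Refines.subst hτ t
    · exact .refl _
  | mix p n g θ ih =>
    simp only [select]
    split_ifs with h
    · exact Term.Refines.subst (fun j => ih _ j _) _
    · exact .refl _

theorem select_mem_support {τ : V → Term S X} {σ : DV → CTerm S → Term S X}
    {D : DV → PMF (Term S X)}
    (hσ : ∀ μ, ∀ s ∈ (ρ.onDist μ).support, σ μ s ∈ (D μ).support)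
    (θ : DistTerm S V DV) {s : CTerm S} (hs : s ∈ (θ.eval ρ).support) :
    θ.select ρ τ σ s ∈ (θ.meval τ D).support := by
  induction θ generalizing s with
  | dvar μ => exact hσ μ s hs
  | dirac t =>
    have hs' : s = t.subst ρ.onTerm := by simpa [eval] using hs
    simp [select, meval, hs']
  | mix p n g θ ih =>
    have h := mem_support_eval_mix.1 hs
    simp only [select, dif_pos h, meval, PMF.mem_support_bind_iff, PMF.mem_support_map_iff,
      mem_support_prodPMF]
    exact ⟨h.choose, h.choose_spec.choose_spec.1, _,
      fun j => ih _ j (h.choose_spec.choose_spec.2.1 j), rfl⟩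

end DistTerm

/-! ### Rearranging the tuples of a diagonal -/

section Cover

universe u v
variable {S : Signature} {A : Type*} {V : Type u} {DV : Type v}

theorem IsDiag.eq_of_apply_eq {L V : Type*} {Y : L → Set V} {diag : Set (L → V)}
    (h : IsDiag Y diag) (hY : ∀ l l', l ≠ l' → Disjoint (Y l) (Y l')) {z z' : L → V}
    (hz : z ∈ diag) (hz' : z' ∈ diag) {l l' : L} (hzz : z l = z' l') : z = z' ∧ l = l' := by
  have hl : l = l' := by
    by_contra hne
    exact Set.disjoint_left.1 (hY l l' hne) (h.mem z hz l) (hzz ▸ h.mem z' hz' l')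
  subst hl
  exact ⟨h.inj z hz z' hz' ⟨l, hzz⟩, rfl⟩

/-- The tuples `z` on which the target of the conclusion or one of the distribution terms that are
tested depends, directly or by some distribution variable `μ_m^z`. -/
def PremShape.tested (s : PremShape S A V DV) (r : Rule S A V DV) : Set (s.L → V) :=
  {z | (∃ m, s.μ m z ∈ r.target.dvars) ∨ (∃ l, z l ∈ r.target.tvars) ∨
    ∃ l m, s.μ m z ∈ (s.θ l).dvars}

variable {r : Rule S A V DV} {X₀ : Set V} {s : PremShape S A V DV}

/-- A distribution variable determines the tuple it belongs to. -/
theorem HasPremShape.finite_setOf_μ_mem (h : HasPremShape r X₀ s) {B : Set DV} (hB : B.Finite) :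
    {z ∈ s.diag | ∃ m, s.μ m z ∈ B}.Finite := by
  have : ∀ z : {z ∈ s.diag | ∃ m, s.μ m z ∈ B}, ∃ m, s.μ m z ∈ B := fun z => z.2.2
  choose m hm using this
  have := hB.to_subtype
  refine Set.finite_coe_iff.1 (Finite.of_injective (β := B) (fun z => ⟨s.μ (m z) z, hm z⟩) ?_)
  intro z z' hzz
  exact Subtype.ext (h.μ_inj _ _ _ z.2.1 _ z'.2.1 (congrArg Subtype.val hzz)).2

/-- Each distribution term has finitely many variables, so the tested tuples in the diagonal are
finite in number if `L` is finite, and at most `|L|` otherwise. In both cases they are fewer than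
the diagonal, which is equipotent to every `Y l`. The remaining tuples have full cardinality and
leave a countable supply for every index in `L`. -/
theorem HasPremShape.exists_embedding (h : HasPremShape r X₀ s) :
    ∃ i : s.L × ℕ → (s.L → V), Function.Injective i ∧ ∀ a, i a ∈ s.diag \ s.tested r := by
  classical
  rcases isEmpty_or_nonempty s.L with hL | ⟨⟨l₀⟩⟩
  · exact ⟨fun a => (hL.false a.1).elim, fun a => (hL.false a.1).elim,
      fun a => (hL.false a.1).elim⟩
  · have hcard : Cardinal.mk s.diag = Cardinal.mk (s.Y l₀) := by
      refine Cardinal.mk_congr (Equiv.ofBijective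
        (fun z : s.diag => (⟨z.1 l₀, h.isDiag.mem _ z.2 _⟩ : s.Y l₀)) ⟨?_, ?_⟩)
      · intro z z' hzz
        exact Subtype.ext (h.isDiag.inj _ z.2 _ z'.2 ⟨l₀, congrArg Subtype.val hzz⟩)
      · intro y
        obtain ⟨z, hz, hzy⟩ := h.isDiag.surj l₀ y y.2
        exact ⟨⟨z, hz⟩, Subtype.ext hzy⟩
    have hinf : Cardinal.aleph0 ≤ Cardinal.mk s.diag := by
      rw [hcard]
      exact Cardinal.infinite_iff.1 (h.infinite l₀).to_subtype
    have hlt : Cardinal.mk s.L < Cardinal.mk s.diag := hcard ▸ h.card_lt l₀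
    have hsub : s.diag ∩ s.tested r ⊆
        ({z ∈ s.diag | ∃ m, s.μ m z ∈ r.target.dvars} ∪ {z ∈ s.diag | ∃ l, z l ∈ r.target.tvars})
          ∪ ⋃ l, {z ∈ s.diag | ∃ m, s.μ m z ∈ (s.θ l).dvars} := by
      rintro z ⟨hz, hm | hl | ⟨l, hlm⟩⟩
      · exact Or.inl (Or.inl ⟨hz, hm⟩)
      · exact Or.inl (Or.inr ⟨hz, hl⟩)
      · exact Or.inr (Set.mem_iUnion.2 ⟨l, hz, hlm⟩)
    have hfinT : {z ∈ s.diag | ∃ l, z l ∈ r.target.tvars}.Finite := by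
      have : ∀ z : {z ∈ s.diag | ∃ l, z l ∈ r.target.tvars}, ∃ l, z.1 l ∈ r.target.tvars :=
        fun z => z.2.2
      choose l hl using this
      have := h.finite_target.1.to_subtype
      refine Set.finite_coe_iff.1
        (Finite.of_injective (β := r.target.tvars) (fun z => ⟨z.1 (l z), hl z⟩) ?_)
      intro z z' hzz
      exact Subtype.ext
        (h.isDiag.eq_of_apply_eq h.disj_Y z.2.1 z'.2.1 (congrArg Subtype.val hzz)).1
    have hfin1 := (h.finite_setOf_μ_mem h.finite_target.2).union hfinT
    have hfin2 := fun l => h.finite_setOf_μ_mem (h.finite_θ l).2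
    have htested : Cardinal.mk ↥(s.diag ∩ s.tested r) < Cardinal.mk s.diag := by
      refine (Cardinal.mk_le_mk_of_subset hsub).trans_lt ?_
      rcases finite_or_infinite s.L with hLf | hLi
      · exact (Cardinal.lt_aleph0_iff_finite.2
          (hfin1.union (Set.finite_iUnion hfin2)).to_subtype).trans_le hinf
      · refine (Cardinal.mk_union_le _ _).trans_lt ?_
        refine Cardinal.add_lt_of_lt hinf
          ((Cardinal.lt_aleph0_iff_finite.2 hfin1.to_subtype).trans_le hinf) ?_
        refine lt_of_le_of_lt ?_ hlt
        refine (Cardinal.mk_iUnion_le_sum_mk.trans (Cardinal.sum_le_sum _ (fun _ => Cardinal.aleph0)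
          fun l => (Cardinal.lt_aleph0_iff_finite.2 (hfin2 l).to_subtype).le)).trans ?_
        rw [Cardinal.sum_const', Cardinal.mul_aleph0_eq (Cardinal.infinite_iff.1 hLi)]
    have hdiff : Cardinal.mk ↥(s.diag \ s.tested r) = Cardinal.mk s.diag := by
      by_contra hne
      have hle : Cardinal.mk ↥(s.diag \ s.tested r) < Cardinal.mk s.diag :=
        lt_of_le_of_ne (Cardinal.mk_le_mk_of_subset Set.sdiff_subset) hne
      have := (Cardinal.mk_union_le (s.diag ∩ s.tested r) (s.diag \ s.tested r)).trans_lt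
        (Cardinal.add_lt_of_lt hinf htested hle)
      rw [Set.inter_union_sdiff] at this
      exact lt_irrefl _ this
    have hemb : Cardinal.mk (s.L × ULift.{u} ℕ) ≤ Cardinal.mk ↥(s.diag \ s.tested r) := by
      rw [hdiff, Cardinal.mk_prod, Cardinal.lift_id, Cardinal.lift_id]
      refine (Cardinal.mul_le_max_of_aleph0_le_right (by simp)).trans (max_le hlt.le ?_)
      simpa using hinf
    obtain ⟨e⟩ := (Cardinal.le_def _ _).1 hemb
    refine ⟨fun a => (e (a.1, ⟨a.2⟩)).1, fun a b hab => ?_, fun a => (e _).2⟩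
    have := e.injective (Subtype.ext hab)
    simp only [Prod.mk.injEq, ULift.up_inj] at this
    exact Prod.ext this.1 this.2

/-- Markings of the variables in the sets `Y l` can be rearranged, without changing those of the
tuples that are tested, such that they exhaust given countable sets of markings. -/
theorem HasPremShape.exists_cover (h : HasPremShape r X₀ s) {X : Type*} {ℓ : X → CTerm S}
    {ρ : V → CTerm S} {τ : V → Term S X} (hτ : ∀ v, (τ v).subst ℓ = ρ v)
    {N : s.L → Set (Term S X)} (hN : ∀ l, (N l).Countable)
    (hleft : ∀ l, ∀ w ∈ N l, ∃ y ∈ s.Y l, ρ y = w.subst ℓ)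
    (hτN : ∀ l, (s.K l).Nonempty → ∀ y ∈ s.Y l, τ y ∈ N l) :
    ∃ (τ' : V → Term S X) (κ : (s.L → V) → (s.L → V)),
      (∀ z ∈ s.diag, κ z ∈ s.diag) ∧
      (∀ v, (∀ l, v ∉ s.Y l) → τ' v = τ v) ∧
      (∀ z ∈ s.diag, z ∈ s.tested r → κ z = z ∧ ∀ l, τ' (z l) = τ (z l)) ∧
      (∀ z ∈ s.diag, ∀ l, (τ' (z l)).subst ℓ = ρ (κ z l)) ∧
      (∀ l, (s.K l).Nonempty → ∀ z ∈ s.diag, τ' (z l) ∈ N l) ∧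
      (∀ l, N l ⊆ τ' '' s.Y l) := by
  classical
  obtain ⟨i, hi, hid⟩ := h.exists_embedding
  obtain ⟨z₀, hz₀⟩ := h.isDiag.nonempty
  have henum : ∀ l, ∃ e : ℕ → Term S X, N l ⊆ Set.range e := fun l => by
    have : Nonempty (Term S X) := ⟨τ (z₀ l)⟩
    exact Set.countable_iff_exists_subset_range.1 (hN l)
  choose e he using henum
  -- Slot `(l, n)` imitates a tuple over which the `n`-th marking in the list for `l` lies, and puts
  -- that marking at position `l`; the other positions keep `τ`. If the list entry is not in `N l`,
  -- the slot is filled by the dummy tuple `z₀`.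
  have hdata : ∀ a : s.L × ℕ, ∃ q : (s.L → V) × (s.L → Term S X), q.1 ∈ s.diag ∧
      (∀ l, (q.2 l).subst ℓ = ρ (q.1 l)) ∧ (∀ l, (s.K l).Nonempty → q.2 l ∈ N l) ∧
      (e a.1 a.2 ∈ N a.1 → q.2 a.1 = e a.1 a.2) := by
    rintro ⟨l, n⟩
    by_cases hmem : e l n ∈ N l
    · obtain ⟨y, hy, hyw⟩ := hleft l _ hmem
      obtain ⟨z, hz, rfl⟩ := h.isDiag.surj l y hy
      refine ⟨(z, Function.update (fun l' => τ (z l')) l (e l n)), hz, fun l' => ?_,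
        fun l' hl' => ?_, fun _ => by simp⟩
      · by_cases hll : l' = l
        · subst hll; simp [hyw]
        · simp [hll, hτ]
      · by_cases hll : l' = l
        · subst hll; simpa using hmem
        · simpa [hll] using hτN l' hl' _ (h.isDiag.mem z hz l')
    · exact ⟨(z₀, fun l => τ (z₀ l)), hz₀, fun l => hτ _,
        fun l hl => hτN l hl _ (h.isDiag.mem z₀ hz₀ l), fun hm => absurd hm hmem⟩
  choose q hq1 hq2 hq3 hq4 using hdata
  let G : (s.L → V) → (s.L → V) × (s.L → Term S X) := fun z =>
    if hz : ∃ a, i a = z then q hz.choose else (z, fun l => τ (z l))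
  have hGi : ∀ a, G (i a) = q a := fun a => by
    have hz : ∃ b, i b = i a := ⟨a, rfl⟩
    simp only [G, dif_pos hz]
    rw [hi hz.choose_spec]
  have hG : ∀ z ∈ s.diag, (G z).1 ∈ s.diag ∧ (∀ l, ((G z).2 l).subst ℓ = ρ ((G z).1 l)) ∧
      ∀ l, (s.K l).Nonempty → (G z).2 l ∈ N l := fun z hz => by
    by_cases ha : ∃ a, i a = z
    · obtain ⟨a, rfl⟩ := ha
      rw [hGi]
      exact ⟨hq1 a, hq2 a, hq3 a⟩
    · simp only [G, dif_neg ha]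
      exact ⟨hz, fun l => hτ _, fun l hl => hτN l hl _ (h.isDiag.mem z hz l)⟩
  -- A variable in some `Y l` occurs in exactly one tuple and at exactly one position, so the choice
  -- is forced.
  let τ' : V → Term S X := fun v =>
    if hv : ∃ zl : (s.L → V) × s.L, zl.1 ∈ s.diag ∧ zl.1 zl.2 = v then
      (G hv.choose.1).2 hv.choose.2 else τ v
  have hτ' : ∀ z ∈ s.diag, ∀ l, τ' (z l) = (G z).2 l := fun z hz l => by
    have hv : ∃ zl : (s.L → V) × s.L, zl.1 ∈ s.diag ∧ zl.1 zl.2 = z l := ⟨(z, l), hz, rfl⟩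
    obtain ⟨h1, h2⟩ := h.isDiag.eq_of_apply_eq h.disj_Y hv.choose_spec.1 hz hv.choose_spec.2
    simp only [τ', dif_pos hv]
    rw [h1, h2]
  refine ⟨τ', fun z => (G z).1, fun z hz => (hG z hz).1, fun v hv => ?_, fun z hz hzt => ?_,
    fun z hz l => ?_, fun l hl z hz => ?_, fun l w hw => ?_⟩
  · refine dif_neg ?_
    rintro ⟨zl, hz, rfl⟩
    exact hv zl.2 (h.isDiag.mem _ hz _)
  · have ha : ¬ ∃ a, i a = z := by
      rintro ⟨a, rfl⟩
      exact (hid a).2 hzt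
    have hGz : G z = (z, fun l => τ (z l)) := dif_neg ha
    exact ⟨congrArg Prod.fst hGz, fun l => by rw [hτ' z hz, hGz]⟩
  · rw [hτ' z hz]
    exact (hG z hz).2.1 l
  · rw [hτ' z hz]
    exact (hG z hz).2.2 l hl
  · obtain ⟨n, rfl⟩ := he l hw
    refine ⟨i (l, n) l, h.isDiag.mem _ (hid _).1 l, ?_⟩
    rw [hτ' _ (hid _).1, hGi]
    exact hq4 (l, n) hw

end Cover

/-! ### Transfer through one rule -/

section Step

universe u v
variable {S : Signature} {A : Type*} {V : Type u} {DV : Type v} {X : Type*}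

/-- The transition `ψ` can be transferred uniformly along the terms `w` that have two closed
instances, given by `ℓ` and by `𝓇`: whenever the source of `ψ` is the first instance of `w`, the
second instance has a transition in `T'`, and the targets of the two transitions are the instances
of the distribution `D w`. Moreover, every element of the support of the target of `ψ` has a
marking in the support of `D w`, and that marking is monotone in `w`. -/
structure IsTransfer (ℓ 𝓇 : X → CTerm S) (T' : Set (PTrn S A)) (ψ : PTrn S A)
    (D : Term S X → PMF (Term S X)) (σ : Term S X → CTerm S → Term S X) : Prop where
  left : ∀ w, w.subst ℓ = ψ.1 → (D w).map (Term.subst ℓ) = ψ.2.2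
  right_mem : ∀ w, w.subst ℓ = ψ.1 → (w.subst 𝓇, ψ.2.1, (D w).map (Term.subst 𝓇)) ∈ T'
  select_left : ∀ w, w.subst ℓ = ψ.1 → ∀ s, (σ w s).subst ℓ = s
  select_mem : ∀ w, w.subst ℓ = ψ.1 → ∀ s ∈ ψ.2.2.support, σ w s ∈ (D w).support
  mono : ∀ w w', w.subst ℓ = ψ.1 → w.Refines ℓ w' → ∀ s, (σ w s).Refines ℓ (σ w' s)

theorem PremShape.inst_subst_subst (s : PremShape S A V DV) {Y Z : Type*} {τ : V → Term S Y}
    {ℓ : Y → Term S Z} {τ' : V → Term S Z} {z z' : s.L → V}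
    (hz : ∀ l, (τ (z l)).subst ℓ = τ' (z' l)) (hW : ∀ w ∈ s.W, (τ w).subst ℓ = τ' w)
    (t : Term S (s.L ⊕ s.W)) : ((s.inst t z).subst τ).subst ℓ = (s.inst t z').subst τ' := by
  simp only [PremShape.inst, Term.subst_subst]
  refine Term.subst_congr fun x _ => ?_
  cases x with
  | inl l => exact hz l
  | inr w => exact hW w w.2

theorem PremShape.inst_subst_congr (s : PremShape S A V DV) {Y : Type*} {τ τ' : V → Term S Y}
    {z : s.L → V} (hz : ∀ l, τ (z l) = τ' (z l)) (hW : ∀ w ∈ s.W, τ w = τ' w)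
    (t : Term S (s.L ⊕ s.W)) : (s.inst t z).subst τ = (s.inst t z).subst τ' := by
  simp only [PremShape.inst, Term.subst_subst]
  refine Term.subst_congr fun x _ => ?_
  cases x with
  | inl l => exact hz l
  | inr w => exact hW w w.2

theorem Cmp.Holds.mono {c : Cmp} (hc : c = Cmp.gt ∨ c = Cmp.ge) {x x' y : ℝ≥0∞} (hx : x ≤ x')
    (h : c.Holds x y) : c.Holds x' y := by
  rcases hc with rfl | rfl
  · exact lt_of_lt_of_le (show y < x from h) hx
  · exact le_trans (show y ≤ x from h) hx

variable {r : Rule S A V DV} {X₀ : Set V} {s : PremShape S A V DV} {ℓ 𝓇 : X → CTerm S}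

/-- If all positive premises of a closed instance of a rule can be transferred, then the variables
in its source can be replaced by terms with two closed instances. -/
theorem HasPremShape.exists_transfer (h : HasPremShape r X₀ s) {T' : Set (PTrn S A)}
    {ρ : ClosedSubst S V DV} (hρ : IsProper ρ r) (hq : ∀ φ ∈ r.quant, φ.Holds ρ)
    (hpos : ∀ φ ∈ r.pos, ∃ D σ, IsTransfer ℓ 𝓇 T' (instPos ρ φ) D σ) :
    ∃ (D : (∀ v, Marking ℓ (ρ.onTerm v)) → PMF (Term S X))
      (σ : (∀ v, Marking ℓ (ρ.onTerm v)) → CTerm S → Term S X),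
      (∀ χ χ', χ ≤ χ' → ∀ s, (σ χ s).Refines ℓ (σ χ' s)) ∧
      ∀ χ, (D χ).map (Term.subst ℓ) = r.target.eval ρ ∧
        (∀ s, (σ χ s).subst ℓ = s) ∧
        (∀ s ∈ (r.target.eval ρ).support, σ χ s ∈ (D χ).support) ∧
        ∃ ρ' : ClosedSubst S V DV,
          (∀ v ∈ X₀, ρ'.onTerm v = (χ v).1.subst 𝓇) ∧
          r.target.eval ρ' = (D χ).map (Term.subst 𝓇) ∧
          IsProper ρ' r ∧ (∀ φ ∈ r.quant, φ.Holds ρ') ∧ (∀ φ ∈ r.pos, instPos ρ' φ ∈ T') ∧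
          ∀ φ ∈ r.neg, ∃ w : Term S X, φ.1.subst ρ'.onTerm = w.subst 𝓇 ∧
            ∃ φ₀ ∈ r.neg, φ₀.2 = φ.2 ∧ φ₀.1.subst ρ.onTerm = w.subst ℓ := by
  classical
  have hpos' : ∀ m z, ∃ D σ, z ∈ s.diag →
      IsTransfer ℓ 𝓇 T' (instPos ρ (s.inst (s.t m) z, s.a m, s.μ m z)) D σ := fun m z => by
    by_cases hz : z ∈ s.diag
    · obtain ⟨D, σ, hD⟩ := hpos (s.inst (s.t m) z, s.a m, s.μ m z)
        (by rw [h.pos_eq]; exact ⟨m, z, hz, rfl⟩)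
      exact ⟨D, σ, fun _ => hD⟩
    · exact ⟨fun w => PMF.pure w, fun w _ => w, fun hz' => absurd hz' hz⟩
  choose Dp σp hp using hpos'
  -- The variable `μ_m^z` receives the distribution transferred from the premise at `κ z`, along the
  -- marking of `t_m(z)`. The fixed point is formed with `κ = id`. Distribution variables outside
  -- the positive premises stay unmarked.
  let E : ((s.L → V) → s.L → V) → (V → Term S X) → DV → PMF (Term S X) := fun κ τ μ =>
    if hμ : ∃ mz : s.M × (s.L → V), mz.2 ∈ s.diag ∧ s.μ mz.1 mz.2 = μ then
      Dp hμ.choose.1 (κ hμ.choose.2) ((s.inst (s.t hμ.choose.1) hμ.choose.2).subst τ)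
    else (ρ.onDist μ).map Term.emb
  let sg : (V → Term S X) → DV → CTerm S → Term S X := fun τ μ =>
    if hμ : ∃ mz : s.M × (s.L → V), mz.2 ∈ s.diag ∧ s.μ mz.1 mz.2 = μ then
      σp hμ.choose.1 hμ.choose.2 ((s.inst (s.t hμ.choose.1) hμ.choose.2).subst τ)
    else Term.emb
  have hchoose : ∀ m, ∀ z ∈ s.diag,
      ∀ hμ : ∃ mz : s.M × (s.L → V), mz.2 ∈ s.diag ∧ s.μ mz.1 mz.2 = s.μ m z,
      hμ.choose = (m, z) := fun m z hz hμ => by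
    obtain ⟨h1, h2⟩ := h.μ_inj _ _ _ hμ.choose_spec.1 _ hz hμ.choose_spec.2
    exact Prod.ext h1 h2
  have hE : ∀ κ τ m, ∀ z ∈ s.diag,
      E κ τ (s.μ m z) = Dp m (κ z) ((s.inst (s.t m) z).subst τ) := fun κ τ m z hz => by
    have hμ : ∃ mz : s.M × (s.L → V), mz.2 ∈ s.diag ∧ s.μ mz.1 mz.2 = s.μ m z :=
      ⟨(m, z), hz, rfl⟩
    simp only [E, dif_pos hμ]
    rw [hchoose m z hz hμ]
  have hsg : ∀ τ m, ∀ z ∈ s.diag,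
      sg τ (s.μ m z) = σp m z ((s.inst (s.t m) z).subst τ) := fun τ m z hz => by
    have hμ : ∃ mz : s.M × (s.L → V), mz.2 ∈ s.diag ∧ s.μ mz.1 mz.2 = s.μ m z :=
      ⟨(m, z), hz, rfl⟩
    simp only [sg, dif_pos hμ]
    rw [hchoose m z hz hμ]
  have hexact : ∀ τ : V → Term S X, (∀ v, (τ v).subst ℓ = ρ.onTerm v) → ∀ t : Term S V,
      (t.subst τ).subst ℓ = t.subst ρ.onTerm := fun τ hτ t => by
    rw [Term.subst_subst]
    exact Term.subst_congr fun v _ => hτ v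
  have hEl : ∀ τ : V → Term S X, (∀ v, (τ v).subst ℓ = ρ.onTerm v) → ∀ μ,
      (E id τ μ).map (Term.subst ℓ) = ρ.onDist μ := fun τ hτ μ => by
    by_cases hμ : ∃ mz : s.M × (s.L → V), mz.2 ∈ s.diag ∧ s.μ mz.1 mz.2 = μ
    · obtain ⟨⟨m, z⟩, hz, rfl⟩ := hμ
      rw [hE _ _ _ _ hz]
      exact (hp m z hz).left _ (hexact τ hτ _)
    · simp only [E, dif_neg hμ, PMF.map_comp]
      have : Term.subst ℓ ∘ Term.emb = id := funext fun t => Term.subst_emb_closed ℓ t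
      rw [this, PMF.map_id]
  have hsgl : ∀ τ : V → Term S X, (∀ v, (τ v).subst ℓ = ρ.onTerm v) → ∀ μ t,
      (sg τ μ t).subst ℓ = t := fun τ hτ μ t => by
    by_cases hμ : ∃ mz : s.M × (s.L → V), mz.2 ∈ s.diag ∧ s.μ mz.1 mz.2 = μ
    · obtain ⟨⟨m, z⟩, hz, rfl⟩ := hμ
      rw [hsg _ _ _ hz]
      exact (hp m z hz).select_left _ (hexact τ hτ _) t
    · simp only [sg, dif_neg hμ]
      exact Term.subst_emb_closed ℓ t
  have hsgm : ∀ τ τ' : V → Term S X, (∀ v, (τ v).subst ℓ = ρ.onTerm v) →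
      (∀ v, (τ v).Refines ℓ (τ' v)) → ∀ μ t, (sg τ μ t).Refines ℓ (sg τ' μ t) :=
    fun τ τ' hτ hττ μ t => by
    by_cases hμ : ∃ mz : s.M × (s.L → V), mz.2 ∈ s.diag ∧ s.μ mz.1 mz.2 = μ
    · obtain ⟨⟨m, z⟩, hz, rfl⟩ := hμ
      rw [hsg _ _ _ hz, hsg _ _ _ hz]
      exact (hp m z hz).mono _ _ (hexact τ hτ _) (Term.Refines.subst hττ _) t
    · simp only [sg, dif_neg hμ]
      exact .refl _
  have hsgs : ∀ τ : V → Term S X, (∀ v, (τ v).subst ℓ = ρ.onTerm v) → ∀ μ,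
      ∀ t ∈ (ρ.onDist μ).support, sg τ μ t ∈ (E id τ μ).support := fun τ hτ μ t ht => by
    by_cases hμ : ∃ mz : s.M × (s.L → V), mz.2 ∈ s.diag ∧ s.μ mz.1 mz.2 = μ
    · obtain ⟨⟨m, z⟩, hz, rfl⟩ := hμ
      rw [hsg _ _ _ hz, hE _ _ _ _ hz]
      exact (hp m z hz).select_mem _ (hexact τ hτ _) t ht
    · simp only [sg, E, dif_neg hμ]
      exact (PMF.mem_support_map_iff _ _ _).2 ⟨t, ht, rfl⟩
  -- A variable in `Y l` is marked by selection from `θ l`, which depends on `τ` through the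
  -- positive premises; this is the possible circularity. All other variables are marked by the
  -- parameter `χ`.
  let F : (∀ v, Marking ℓ (ρ.onTerm v)) → (∀ v, Marking ℓ (ρ.onTerm v)) →
      ∀ v, Marking ℓ (ρ.onTerm v) := fun χ τ v =>
    if hv : ∃ l, v ∈ s.Y l then
      ⟨(s.θ hv.choose).select ρ (fun v => (τ v).1) (sg fun v => (τ v).1) (ρ.onTerm v),
        DistTerm.select_subst (fun v => (τ v).2) (hsgl _ fun v => (τ v).2) _ _⟩
    else χ v
  obtain ⟨fp, hfp, hfix⟩ := Marking.exists_fixedPoint F (by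
    intro χ χ' hχ τ τ' hτ v
    by_cases hv : ∃ l, v ∈ s.Y l
    · simp only [F, dif_pos hv]
      exact DistTerm.select_refines hτ (hsgm _ _ (fun v => (τ v).2) hτ) _ _
    · simp only [F, dif_neg hv]
      exact hχ v)
  refine ⟨fun χ => r.target.meval (fun v => (fp χ v).1) (E id fun v => (fp χ v).1),
    fun χ => r.target.select ρ (fun v => (fp χ v).1) (sg fun v => (fp χ v).1),
    fun χ χ' hχ => DistTerm.select_refines (hfp hχ)
      (hsgm _ _ (fun v => (fp χ v).2) (hfp hχ)) _, fun χ => ?_⟩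
  set τ : V → Term S X := fun v => (fp χ v).1
  have hτ : ∀ v, (τ v).subst ℓ = ρ.onTerm v := fun v => (fp χ v).2
  have hτX : ∀ v, (∀ l, v ∉ s.Y l) → τ v = (χ v).1 := fun v hv => by
    have hv' : ¬ ∃ l, v ∈ s.Y l := fun ⟨l, hl⟩ => hv l hl
    have := congrArg Marking.val (congrFun (hfix χ) v)
    simp only [F, dif_neg hv'] at this
    exact this.symm
  have hτY : ∀ l, ∀ v ∈ s.Y l, τ v = (s.θ l).select ρ τ (sg τ) (ρ.onTerm v) := fun l v hl => by
    have hv' : ∃ l, v ∈ s.Y l := ⟨l, hl⟩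
    have := congrArg Marking.val (congrFun (hfix χ) v)
    simp only [F, dif_pos hv'] at this
    have hll : hv'.choose = l := by
      by_contra hne
      exact Set.disjoint_left.1 (h.disj_Y _ _ hne) hv'.choose_spec hl
    rw [hll] at this
    exact this.symm
  have hmeval : ∀ θ : DistTerm S V DV,
      (θ.meval τ (E id τ)).map (Term.subst ℓ) = θ.eval ρ := fun θ => by
    rw [DistTerm.meval_map_subst, DistTerm.eval_eq_meval]
    exact DistTerm.meval_congr (fun v _ => hτ v) fun μ _ => hEl τ hτ μ
  refine ⟨hmeval _, DistTerm.select_subst hτ (hsgl τ hτ) _, fun t ht =>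
    DistTerm.select_mem_support (hsgs τ hτ) _ ht, ?_⟩
  -- These are all markings that `Y l` has to reach to preserve the mass, not only the selected
  -- ones.
  let N : s.L → Set (Term S X) := fun l =>
    {w | w ∈ ((s.θ l).meval τ (E id τ)).support ∧ ∃ y ∈ s.Y l, ρ.onTerm y = w.subst ℓ}
  obtain ⟨τ', κ, hκ, hτ'X, hτ't, hτ'l, hτ'N, hNτ'⟩ := h.exists_cover hτ (N := N)
    (fun l => (PMF.support_countable _).mono fun w hw => hw.1) (fun l w hw => hw.2)
    -- Properness of `ρ` puts the values of `Y l` into the support, but only if there is a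
    -- quantitative premise for `l`.
    (fun l ⟨k, hk⟩ y hy => by
      refine ⟨?_, y, hy, (hτ y).symm⟩
      rw [hτY l y hy]
      refine DistTerm.select_mem_support (hsgs τ hτ) _ ?_
      rw [PMF.mem_support_iff]
      exact (hρ ⟨s.θ l, s.Y l, k.1, k.2⟩ (by rw [h.quant_eq]; exact ⟨l, k, hk, rfl⟩) y hy).ne')
  have hW : ∀ w ∈ s.W, τ' w = τ w := fun w hw =>
    hτ'X w fun l => Set.disjoint_left.1 (h.disj_W l) hw
  have hinst : ∀ t, ∀ z ∈ s.diag,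
      ((s.inst t z).subst τ').subst ℓ = (s.inst t (κ z)).subst ρ.onTerm := fun t z hz =>
    s.inst_subst_subst (hτ'l z hz) (fun w hw => by rw [hW w hw, hτ]) t
  -- Tested tuples are untouched by the rearrangement, so the target and all `θ l` keep their marked
  -- distributions.
  have hEκ : ∀ μ, (∀ m, ∀ z ∈ s.diag, s.μ m z = μ → z ∈ s.tested r) →
      E κ τ' μ = E id τ μ := fun μ hμt => by
    by_cases hμ : ∃ mz : s.M × (s.L → V), mz.2 ∈ s.diag ∧ s.μ mz.1 mz.2 = μ
    · obtain ⟨⟨m, z⟩, hz, rfl⟩ := hμ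
      obtain ⟨h1, h2⟩ := hτ't z hz (hμt m z hz rfl)
      rw [hE _ _ _ _ hz, hE _ _ _ _ hz, h1, s.inst_subst_congr h2 hW]
      rfl
    · simp only [E, dif_neg hμ]
  have htarget : r.target.meval τ' (E κ τ') = r.target.meval τ (E id τ) := by
    refine DistTerm.meval_congr (fun v hv => ?_) fun μ hμ => hEκ μ ?_
    · by_cases hY : ∃ l, v ∈ s.Y l
      · obtain ⟨l, hl⟩ := hY
        obtain ⟨z, hz, rfl⟩ := h.isDiag.surj l v hl
        exact (hτ't z hz (Or.inr (Or.inl ⟨l, hv⟩))).2 l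
      · exact hτ'X v fun l hl => hY ⟨l, hl⟩
    · rintro m z hz rfl
      exact Or.inl ⟨m, hμ⟩
  have hθ : ∀ l, (s.θ l).meval τ' (E κ τ') = (s.θ l).meval τ (E id τ) := fun l => by
    refine DistTerm.meval_congr (fun v hv => hτ'X v fun l' hl' => ?_) fun μ hμ => hEκ μ ?_
    · exact Set.disjoint_left.1 (h.disj_θ l) hv (Or.inr (Set.mem_iUnion.2 ⟨l', hl'⟩))
    · rintro m z hz rfl
      exact Or.inr (Or.inr ⟨l, m, hμ⟩)
  let ρ' : ClosedSubst S V DV :=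
    ⟨fun v => (τ' v).subst 𝓇, fun μ => (E κ τ' μ).map (Term.subst 𝓇)⟩
  have heval : ∀ θ : DistTerm S V DV,
      θ.eval ρ' = (θ.meval τ' (E κ τ')).map (Term.subst 𝓇) := fun θ => by
    rw [DistTerm.meval_map_subst, DistTerm.eval_eq_meval]
  refine ⟨ρ', fun v hv => ?_, ?_, ?_, ?_, ?_, ?_⟩
  · have hvY : ∀ l, v ∉ s.Y l := fun l hl => Set.disjoint_left.1 (h.disj_X l) hl hv
    show (τ' v).subst 𝓇 = _
    rw [hτ'X v hvY, hτX v hvY]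
  · rw [heval, htarget]
  · intro φ hφ w hw
    rw [h.quant_eq] at hφ
    obtain ⟨l, k, hk, rfl⟩ := hφ
    obtain ⟨z, hz, rfl⟩ := h.isDiag.surj l w hw
    rw [pos_iff_ne_zero, ← PMF.mem_support_iff, heval, hθ]
    exact (PMF.mem_support_map_iff _ _ _).2 ⟨_, (hτ'N l ⟨k, hk⟩ z hz).1, rfl⟩
  · intro φ hφ
    have hφρ := hq φ hφ
    rw [h.quant_eq] at hφ
    obtain ⟨l, k, hk, rfl⟩ := hφ
    -- Both masses are masses of preimages under one marked distribution. Within its support, a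
    -- marking over `ρ(Y l)` lies in `N l`, hence in `τ'(Y l)`, and its right instance lies in `ρ'(Y
    -- l)`. So the mass does not decrease, which suffices for `>` and `≥`.
    refine Cmp.Holds.mono (h.cmp l k hk) ?_ hφρ
    simp only [heval, hθ, ← hmeval, mass_map]
    refine mass_mono_of_inter_support ?_
    rintro w ⟨⟨y, hy, hyw⟩, hw⟩
    obtain ⟨y', hy', rfl⟩ := hNτ' l ⟨hw, y, hy, hyw⟩
    exact ⟨y', hy', rfl⟩
  · intro φ hφ
    rw [h.pos_eq] at hφ
    obtain ⟨m, z, hz, rfl⟩ := hφ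
    -- Under `τ'`, the term `t_m(z)` is a marking of the original instance of `t_m(κ z)`, so the
    -- premise at `κ z` is the one to transfer.
    have := (hp m (κ z) (hκ z hz)).right_mem _ (hinst (s.t m) z hz)
    rw [← hE κ τ' m z hz, Term.subst_subst] at this
    exact this
  · intro φ hφ
    rw [h.neg_eq] at hφ
    obtain ⟨n, hn, z, hz, rfl⟩ := hφ
    refine ⟨(s.inst n.1 z).subst τ', (Term.subst_subst _ _ _).symm,
      (s.inst n.1 (κ z), n.2), ?_, rfl, (hinst n.1 z hz).symm⟩
    rw [h.neg_eq]
    exact ⟨n, hn, κ z, hκ z hz, rfl⟩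

end Step

/-! ### Markings of the source of a rule -/

section Source

variable {S : Signature} {A V DV X : Type*}

/-- Markings of the source of a closed instance of a rule come from markings of the variables. -/
theorem exists_source_marking_app (ℓ : X → CTerm S) (f : S.F) {x : Fin (S.ar f) → V}
    (hx : Function.Injective x) (ρ : V → CTerm S) :
    ∃ χ : Term S X → ∀ v, Marking ℓ (ρ v),
      (∀ (g : S.F) ws, (Term.app g ws).subst ℓ = (Term.app f fun i => Term.var (x i)).subst ρ →
        (Term.app f fun i => Term.var (x i)).subst (fun v => (χ (Term.app g ws) v).1)
          = Term.app g ws) ∧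
      ∀ (g : S.F) ws ws', (Term.app g ws).subst ℓ
          = (Term.app f fun i => Term.var (x i)).subst ρ →
        (∀ i, (ws i).Refines ℓ (ws' i)) → χ (Term.app g ws) ≤ χ (Term.app g ws') := by
  classical
  -- A relation avoids transporting tuples of arguments along equalities of function names.
  -- Variables outside the source get the least marking, which keeps `χ` monotone.
  let Q : Term S X → V → Term S X → Prop := fun w v t =>
    ∃ i ws, x i = v ∧ w = Term.app f ws ∧ ws i = t ∧ t.subst ℓ = ρ v
  let χ : Term S X → ∀ v, Marking ℓ (ρ v) := fun w v =>
    if h : ∃ t, Q w v t then ⟨h.choose, by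
      obtain ⟨i, ws, -, -, -, ht⟩ := h.choose_spec
      exact ht⟩
    else ⊥
  have hQ : ∀ ws i t, Q (Term.app f ws) (x i) t → t = ws i := by
    rintro ws i t ⟨j, ws', hij, hw, rfl, -⟩
    cases hx hij
    cases hw
    rfl
  have hχ : ∀ ws i, (ws i).subst ℓ = ρ (x i) → (χ (Term.app f ws) (x i)).1 = ws i := by
    intro ws i hi
    have hex : ∃ t, Q (Term.app f ws) (x i) t := ⟨ws i, i, ws, rfl, rfl, rfl, hi⟩
    simp only [χ, dif_pos hex]
    exact hQ ws i _ hex.choose_spec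
  refine ⟨χ, fun g ws h => ?_, fun g ws ws' h hws v => ?_⟩
  · obtain ⟨rfl, hargs⟩ := Term.app.inj h
    have hargs := congrFun (eq_of_heq hargs)
    exact congrArg (Term.app g) (funext fun i => hχ ws i (hargs i))
  · obtain ⟨rfl, hargs⟩ := Term.app.inj h
    have hargs := congrFun (eq_of_heq hargs)
    by_cases hv : ∃ i, x i = v
    · obtain ⟨i, rfl⟩ := hv
      show Term.Refines ℓ (χ _ _).1 (χ _ _).1
      rw [hχ ws i (hargs i), hχ ws' i ((hws i).subst_eq.symm.trans (hargs i))]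
      exact hws i
    · have : χ (Term.app g ws) v = ⊥ := dif_neg fun ⟨t, i, _, hi, _⟩ => hv ⟨i, hi⟩
      rw [this]
      exact bot_le

theorem exists_source_marking_var (ℓ : X → CTerm S) (x : V) (ρ : V → CTerm S) :
    ∃ χ : Term S X → ∀ v, Marking ℓ (ρ v),
      (∀ w, w.subst ℓ = ρ x → (χ w x).1 = w) ∧
      ∀ w w', w.subst ℓ = ρ x → w.Refines ℓ w' → χ w ≤ χ w' := by
  classical
  let χ : Term S X → ∀ v, Marking ℓ (ρ v) := fun w v =>
    if h : v = x ∧ w.subst ℓ = ρ v then ⟨w, h.2⟩ else ⊥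
  have hχ : ∀ w, w.subst ℓ = ρ x → (χ w x).1 = w := fun w hw => by
    simp only [χ, dif_pos (show x = x ∧ w.subst ℓ = ρ x from ⟨rfl, hw⟩)]
  refine ⟨χ, hχ, fun w w' hw hww v => ?_⟩
  by_cases hv : v = x
  · subst hv
    show Term.Refines ℓ (χ w v).1 (χ w' v).1
    rw [hχ w hw, hχ w' (hww.subst_eq.symm.trans hw)]
    exact hww
  · have : χ w v = ⊥ := dif_neg fun h => hv h.1
    rw [this]
    exact bot_le

universe u v

/-- Only markings with a function name at the root are matched with the source of a rule; a marking
that is a single pair is treated by bisimilarity instead. -/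
theorem exists_source_marking {V : Type u} {DV : Type v} {r : Rule S A V DV}
    (hr : IsNtMuF r ∨ IsNtMuX r) (ℓ : X → CTerm S) (ρ : V → CTerm S) :
    ∃ X₀ s, HasPremShape r X₀ s ∧ r.source.vars ⊆ X₀ ∧ ∃ χ : Term S X → ∀ v, Marking ℓ (ρ v),
      (∀ (g : S.F) ws, (Term.app g ws).subst ℓ = r.source.subst ρ →
        r.source.subst (fun v => (χ (Term.app g ws) v).1) = Term.app g ws) ∧
      ∀ (g : S.F) ws ws', (Term.app g ws).subst ℓ = r.source.subst ρ →
        (∀ i, (ws i).Refines ℓ (ws' i)) → χ (Term.app g ws) ≤ χ (Term.app g ws') := by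
  rcases hr with ⟨f, x, hx, hsrc, s, hs⟩ | ⟨x, hsrc, s, hs⟩
  · refine ⟨_, s, hs, ?_, ?_⟩
    · rw [hsrc]
      rintro y ⟨i, hi⟩
      exact ⟨i, hi.symm⟩
    · rw [hsrc]
      exact exists_source_marking_app ℓ f hx ρ
  · refine ⟨_, s, hs, ?_, ?_⟩
    · rw [hsrc]
      exact subset_rfl
    · rw [hsrc]
      obtain ⟨χ, h1, h2⟩ := exists_source_marking_var ℓ x ρ
      exact ⟨χ, fun g ws h => h1 _ h, fun g ws ws' h hws => h2 _ _ h (.app g ws ws' hws)⟩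

end Source

/-! ### Bisimilarity is an equivalence relation -/

section Bisimilarity

variable {S : Signature} {A V DV : Type*} {T : Set (PTrn S A)}

theorem Bisimilar.exists_liftRel {t t' : CTerm S} (h : Bisimilar T t t') {a : A}
    {π : PMF (CTerm S)} (hπ : (t, a, π) ∈ T) :
    ∃ π', (t', a, π') ∈ T ∧ LiftRel (Bisimilar T) π π' := by
  obtain ⟨R, hR, htt⟩ := h
  obtain ⟨π', hπ', hl⟩ := hR.2 t t' htt a π hπ
  exact ⟨π', hπ', hl.mono fun a b hab => ⟨R, hR, hab⟩⟩

/-- For transitivity, the composite of bisimilarity with itself is a bisimulation: it contains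
bisimilarity by reflexivity, so a set closed under it is closed under bisimilarity, and the two
equalities of masses can be chained. -/
theorem bisimilar_equivalence (T : Set (PTrn S A)) : Equivalence (Bisimilar T) where
  refl t := ⟨Eq, ⟨fun _ _ h => h.symm, by
    rintro t _ rfl a π hπ
    exact ⟨π, hπ, fun _ _ => rfl⟩⟩, rfl⟩
  symm := fun ⟨R, hR, h⟩ => ⟨R, hR, hR.1 _ _ h⟩
  trans := by
    have hrefl : ∀ t, Bisimilar T t t := fun t => ⟨Eq, ⟨fun _ _ h => h.symm, by
      rintro t _ rfl a π hπ
      exact ⟨π, hπ, fun _ _ => rfl⟩⟩, rfl⟩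
    have hsymm : ∀ t t', Bisimilar T t t' → Bisimilar T t' t :=
      fun _ _ ⟨R, hR, h⟩ => ⟨R, hR, hR.1 _ _ h⟩
    intro t₁ t₂ t₃ h₁ h₂
    refine ⟨fun t t' => ∃ t'', Bisimilar T t t'' ∧ Bisimilar T t'' t', ⟨?_, ?_⟩, t₂, h₁, h₂⟩
    · rintro t t' ⟨t'', h, h'⟩
      exact ⟨t'', hsymm _ _ h', hsymm _ _ h⟩
    · rintro t t' ⟨t'', h, h'⟩ a π hπ
      obtain ⟨π'', hπ'', hl⟩ := h.exists_liftRel hπ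
      obtain ⟨π', hπ', hl'⟩ := h'.exists_liftRel hπ''
      have hsub : ∀ u u', Bisimilar T u u' → ∃ u'', Bisimilar T u u'' ∧ Bisimilar T u'' u' :=
        fun u u' hu => ⟨u', hu, hrefl u'⟩
      exact ⟨π', hπ', fun Q hQ => (hl.mono hsub Q hQ).trans (hl'.mono hsub Q hQ)⟩

end Bisimilarity

/-! ### Strata and derivability -/

section Derivations

variable {S : Signature} {A V DV : Type*}

/-- Derivability of transitions when negative premises are checked against the set `T`. -/
inductive Derivable (P : PTSS S A V DV) (T : Set (PTrn S A)) : PTrn S A → Prop where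
  | intro (r : Rule S A V DV) (hr : r ∈ P) (ρ : ClosedSubst S V DV) (hρ : IsProper ρ r)
      (hpos : ∀ φ ∈ r.pos, Derivable P T (instPos ρ φ))
      (hquant : ∀ φ ∈ r.quant, φ.Holds ρ)
      (hneg : ∀ φ ∈ r.neg, ∀ π : PMF (CTerm S), (φ.1.subst ρ.onTerm, φ.2, π) ∉ T) :
      Derivable P T (instConc ρ r)

variable {P : PTSS S A V DV} {str : PTrn S A → Ordinal}

theorem mem_stratum {β : Ordinal} {ψ : PTrn S A} : ψ ∈ stratum P str β ↔
    InStratum P str β {χ | ∃ γ, ∃ _ : γ < β, χ ∈ stratum P str γ} ψ := by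
  rw [stratum]
  rfl

theorem str_eq_of_mem_stratum {β : Ordinal} {ψ : PTrn S A} (h : ψ ∈ stratum P str β) :
    str ψ = β := by
  rw [mem_stratum] at h
  cases h
  assumption

theorem mem_stratum_of_mem_transRel {ψ : PTrn S A} (h : ψ ∈ transRel P str) :
    ψ ∈ stratum P str (str ψ) := by
  obtain ⟨β, hβ⟩ := h
  rwa [str_eq_of_mem_stratum hβ]

theorem IsStratification.instConc_mem_transRel (hstr : IsStratification P str)
    {r : Rule S A V DV} (hr : r ∈ P) {ρ : ClosedSubst S V DV} (hρ : IsProper ρ r)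
    (hpos : ∀ φ ∈ r.pos, instPos ρ φ ∈ transRel P str) (hquant : ∀ φ ∈ r.quant, φ.Holds ρ)
    (hneg : ∀ φ ∈ r.neg, ∀ π : PMF (CTerm S),
      (φ.1.subst ρ.onTerm, φ.2, π) ∉ transRel P str) :
    instConc ρ r ∈ transRel P str := by
  refine ⟨str (instConc ρ r), mem_stratum.2 (.intro r hr ρ hρ rfl (fun φ hφ hlow => ?_) hquant
    fun φ hφ π hlow => hneg φ hφ π ?_)⟩
  · have hmem := mem_stratum_of_mem_transRel (hpos φ hφ)
    rcases ((hstr r hr ρ hρ).1 φ hφ).lt_or_eq with hlt | heq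
    · exact absurd ⟨_, hlt, hmem⟩ hlow
    · rw [heq] at hmem
      exact mem_stratum.1 hmem
  · obtain ⟨γ, -, hγ⟩ := hlow
    exact ⟨γ, hγ⟩

/-- The induction is on strata, and inside a stratum on the derivation. A valid transition that
denies a negative premise lies in its own stratum, which is below that of the conclusion, so
checking against lower strata amounts to checking against the whole relation. -/
theorem IsStratification.derivable (hstr : IsStratification P str) {ψ : PTrn S A}
    (h : ψ ∈ transRel P str) : Derivable P (transRel P str) ψ := by
  obtain ⟨β, hβ⟩ := h
  induction β using WellFoundedLT.induction generalizing ψ with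
  | ind β ih =>
    rw [mem_stratum] at hβ
    induction hβ with
    | intro r hr ρ hρ hβ hpos hquant hneg ihpos =>
      refine .intro r hr ρ hρ (fun φ hφ => ?_) hquant fun φ hφ π hT => ?_
      · by_cases hlow : instPos ρ φ ∈ {χ | ∃ γ, ∃ _ : γ < β, χ ∈ stratum P str γ}
        · obtain ⟨γ, hγ, hmem⟩ := hlow
          exact ih γ hγ hmem
        · exact ihpos φ hφ hlow
      · exact hneg φ hφ π ⟨_, hβ ▸ (hstr r hr ρ hρ).2 φ hφ π, mem_stratum_of_mem_transRel hT⟩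

end Derivations

/-! ### Transfer along derivations, and the induction on strata -/

section Congruence

universe u v
variable {S : Signature} {A : Type*} {V : Type u} {DV : Type v}

/-- The pairs of bisimilar terms, which mark the subterms of a term that may be replaced. -/
abbrev BisimPair (T : Set (PTrn S A)) := {x : CTerm S × CTerm S // Bisimilar T x.1 x.2}

/-- The first closed instance of a marked term. -/
def BisimPair.left {T : Set (PTrn S A)} (x : BisimPair T) : CTerm S := x.1.1

/-- The second closed instance of a marked term. -/
def BisimPair.right {T : Set (PTrn S A)} (x : BisimPair T) : CTerm S := x.1.2

/-- Reversing every pair lets statements about left instances be used from right to left, as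
negative premises require. -/
theorem BisimPair.exists_swap {T : Set (PTrn S A)} (w : Term S (BisimPair T)) :
    ∃ w' : Term S (BisimPair T), w'.subst BisimPair.left = w.subst BisimPair.right ∧
      w'.subst BisimPair.right = w.subst BisimPair.left := by
  refine ⟨w.subst fun x => Term.var ⟨(x.1.2, x.1.1), (bisimilar_equivalence T).symm x.2⟩, ?_, ?_⟩
  · rw [Term.subst_subst]; rfl
  · rw [Term.subst_subst]; rfl

/-- Transitions of bisimilar terms can be matched by distributions on marked terms. -/
theorem BisimPair.exists_matching {T : Set (PTrn S A)} {a : A} {π : PMF (CTerm S)}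
    (x : BisimPair T) : ∃ (D : PMF (Term S (BisimPair T)))
      (σ : CTerm S → Term S (BisimPair T)), (x.left, a, π) ∈ T →
      D.map (Term.subst BisimPair.left) = π ∧
      (x.right, a, D.map (Term.subst BisimPair.right)) ∈ T ∧
      (∀ s, (σ s).subst BisimPair.left = s) ∧ ∀ s ∈ π.support, σ s ∈ D.support := by
  classical
  by_cases hπ : (x.left, a, π) ∈ T
  · obtain ⟨π', hπ', hl⟩ := x.2.exists_liftRel hπ
    obtain ⟨Γ, h1, h2⟩ := hl.exists_coupling (bisimilar_equivalence T)
    let σ : CTerm S → Term S (BisimPair T) := fun s =>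
      if h : ∃ y ∈ Γ.support, y.1.1 = s then Term.var h.choose else Term.emb s
    refine ⟨Γ.map Term.var, σ, fun _ => ⟨?_, ?_, fun s => ?_, fun s hs => ?_⟩⟩
    · rw [PMF.map_comp, ← h1]; rfl
    · rw [PMF.map_comp]
      rw [← h2] at hπ'
      exact hπ'
    · by_cases h : ∃ y ∈ Γ.support, y.1.1 = s
      · simp only [σ, dif_pos h]
        exact h.choose_spec.2
      · simp only [σ, dif_neg h]
        exact Term.subst_emb_closed _ _
    · rw [← h1, PMF.mem_support_map_iff] at hs
      simp only [σ, dif_pos hs]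
      exact (PMF.mem_support_map_iff _ _ _).2 ⟨_, hs.choose_spec.1, rfl⟩
  · exact ⟨PMF.pure (Term.var x), Term.emb, fun h => absurd h hπ⟩

/-- The induction on derivations is independent of how negative premises are refuted: that is
delegated to `hclose`. The set `T'` and the invariant `G`, passed from conclusions to positive
premises, allow it to be run for both matching statements. -/
theorem Derivable.exists_isTransfer {P : PTSS S A V DV} (hP : InFormat P)
    {T T' : Set (PTrn S A)} (hT : ∀ ψ, Derivable P T ψ → ψ ∈ T) (hTT' : T ⊆ T')
    {G : PTrn S A → Prop}
    (hG : ∀ r ∈ P, ∀ ρ, IsProper ρ r → G (instConc ρ r) → ∀ φ ∈ r.pos, G (instPos ρ φ))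
    (hclose : ∀ r ∈ P, ∀ ρ ρ' : ClosedSubst S V DV, IsProper ρ r → G (instConc ρ r) →
      (∀ φ ∈ r.neg, ∀ π : PMF (CTerm S), (φ.1.subst ρ.onTerm, φ.2, π) ∉ T) →
      IsProper ρ' r → (∀ φ ∈ r.quant, φ.Holds ρ') → (∀ φ ∈ r.pos, instPos ρ' φ ∈ T') →
      (∀ φ ∈ r.neg, ∃ w : Term S (BisimPair T),
        φ.1.subst ρ'.onTerm = w.subst BisimPair.right ∧
        ∃ φ₀ ∈ r.neg, φ₀.2 = φ.2 ∧ φ₀.1.subst ρ.onTerm = w.subst BisimPair.left) →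
      instConc ρ' r ∈ T')
    {ψ : PTrn S A} (hψ : Derivable P T ψ) (hGψ : G ψ) :
    ∃ D σ, IsTransfer BisimPair.left (BisimPair.right (T := T)) T' ψ D σ := by
  classical
  have hψ' := hψ
  induction hψ' with
  | intro r hr ρ hρ hpos hquant hneg ih =>
    obtain ⟨X₀, s, hs, hX₀, χ, hχ, hχm⟩ :=
      exists_source_marking (hP r hr) (BisimPair.left (T := T)) ρ.onTerm
    obtain ⟨D, σ, hσm, hD⟩ := hs.exists_transfer hρ hquant
      fun φ hφ => ih φ hφ (hpos φ hφ) (hG r hr ρ hρ hGψ φ hφ)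
    choose Da σa ha using
      BisimPair.exists_matching (T := T) (a := r.label) (π := r.target.eval ρ)
    have hmem : (r.source.subst ρ.onTerm, r.label, r.target.eval ρ) ∈ T := hT _ hψ
    -- An unmarked source keeps the original target, unmarked, whatever its root. This is forced by
    -- monotonicity: the unmarked source lies below all markings, among them single pairs, whose
    -- couplings are unrelated to the rule.
    let D' : Term S (BisimPair T) → PMF (Term S (BisimPair T)) := fun w =>
      if w = Term.emb (w.subst BisimPair.left) then (r.target.eval ρ).map Term.emb
      else match w with
        | Term.var x => Da x
        | Term.app g ws => D (χ (Term.app g ws))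
    let σ' : Term S (BisimPair T) → CTerm S → Term S (BisimPair T) := fun w =>
      if w = Term.emb (w.subst BisimPair.left) then Term.emb
      else match w with
        | Term.var x => σa x
        | Term.app g ws => σ (χ (Term.app g ws))
    have hall : ∀ w : Term S (BisimPair T), w.subst BisimPair.left = r.source.subst ρ.onTerm →
        (D' w).map (Term.subst BisimPair.left) = r.target.eval ρ ∧
        (w.subst BisimPair.right, r.label, (D' w).map (Term.subst BisimPair.right)) ∈ T' ∧
        (∀ s, (σ' w s).subst BisimPair.left = s) ∧
        ∀ s ∈ (r.target.eval ρ).support, σ' w s ∈ (D' w).support := by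
      intro w hw
      by_cases hemb : w = Term.emb (w.subst BisimPair.left)
      · have hcomp : ∀ ℓ : BisimPair T → CTerm S, Term.subst ℓ ∘ Term.emb = id := fun ℓ =>
          funext fun t => Term.subst_emb_closed ℓ t
        simp only [D', σ', if_pos hemb, PMF.map_comp, hcomp, PMF.map_id]
        refine ⟨trivial, ?_, fun s => Term.subst_emb_closed _ s, fun s hs =>
          (PMF.mem_support_map_iff _ _ _).2 ⟨s, hs, rfl⟩⟩
        rw [hemb, Term.subst_emb_closed, hw]
        exact hTT' hmem
      · simp only [D', σ', if_neg hemb]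
        cases w with
        | var x =>
          obtain ⟨h1, h2, h3, h4⟩ := ha x (by rw [← hw] at hmem; exact hmem)
          exact ⟨h1, hTT' h2, h3, h4⟩
        | app g ws =>
          obtain ⟨h1, h2, h3, ρ', hρX, hρt, hρ', hq', hp', hn'⟩ := hD (χ (Term.app g ws))
          refine ⟨h1, ?_, h2, h3⟩
          have := hclose r hr ρ ρ' hρ hGψ hneg hρ' hq' hp' hn'
          rw [instConc, hρt, Term.subst_congr (fun v hv => hρX v (hX₀ hv)),
            ← Term.subst_subst, hχ g ws hw] at this
          exact this
    refine ⟨D', σ', fun w hw => (hall w hw).1, fun w hw => (hall w hw).2.1,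
      fun w hw => (hall w hw).2.2.1, fun w hw => (hall w hw).2.2.2, fun w w' hw hww t => ?_⟩
    by_cases hemb : w = Term.emb (w.subst BisimPair.left)
    · have h1 : σ' w t = Term.emb t := by simp only [σ', if_pos hemb]
      have h2 := (hall w' (hww.subst_eq.symm.trans hw)).2.2.1 t
      rw [h1]
      conv_lhs => rw [← h2]
      exact .bot _
    · have hemb' : w' ≠ Term.emb (w'.subst BisimPair.left) := fun he => hemb (by
        rw [hww.subst_eq, ← he]
        exact hww.eq_of_occ_le (by rw [he, Term.occ_emb]; exact Nat.zero_le _))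
      simp only [σ', if_neg hemb, if_neg hemb']
      cases hww with
      | bot _ => exact absurd (by rw [Term.subst_emb_closed]) hemb
      | var x => exact .refl _
      | app g ws ws' hws => exact hσm _ _ (hχm g ws ws' hw hws) t

/-- One direction of the matching of transitions, up to stratum `α`: transitions of the first
instance of a marked term of stratum at most `α` are matched by the second instance. -/
def MatchesUpTo (T : Set (PTrn S A)) (str : PTrn S A → Ordinal) (α : Ordinal) : Prop :=
  ∀ (w : Term S (BisimPair T)) (a : A) (π : PMF (CTerm S)), (w.subst BisimPair.left, a, π) ∈ T →
    str (w.subst BisimPair.left, a, π) ≤ α → ∃ π', (w.subst BisimPair.right, a, π') ∈ T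

/-- Another direction of the matching of transitions: transitions of the first instance of a marked
term are matched by the second instance, possibly by conceivable transitions that do not belong to
a stratum below `α`. -/
def MatchesBeyond (T : Set (PTrn S A)) (str : PTrn S A → Ordinal) (α : Ordinal) : Prop :=
  ∀ (w : Term S (BisimPair T)) (a : A) (π : PMF (CTerm S)), (w.subst BisimPair.left, a, π) ∈ T →
    ∃ π', str (w.subst BisimPair.right, a, π') < α → (w.subst BisimPair.right, a, π') ∈ T

variable {P : PTSS S A V DV} {str : PTrn S A → Ordinal}

theorem IsStratification.mem_of_derivable (hstr : IsStratification P str) {ψ : PTrn S A}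
    (h : Derivable P (transRel P str) ψ) : ψ ∈ transRel P str := by
  induction h with
  | intro r hr ρ hρ hpos hquant hneg ih => exact hstr.instConc_mem_transRel hr hρ ih hquant hneg

/-- If a negative premise failed on the right, `MatchesBeyond` applied to the swapped marking would
give a conceivable transition on the left. Its stratum is below that of the original conclusion,
hence below `α`, so it is valid and violates the original negative premise. -/
theorem IsStratification.exists_isTransfer (hstr : IsStratification P str) (hP : InFormat P)
    {α : Ordinal} (hα : MatchesBeyond (transRel P str) str α) {ψ : PTrn S A}
    (hψ : ψ ∈ transRel P str) (hψα : str ψ ≤ α) :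
    ∃ D σ, IsTransfer BisimPair.left (BisimPair.right (T := transRel P str))
      (transRel P str) ψ D σ := by
  refine Derivable.exists_isTransfer (G := fun ψ => str ψ ≤ α) hP
    (fun _ => hstr.mem_of_derivable) subset_rfl
    (fun r hr ρ hρ hc φ hφ => ((hstr r hr ρ hρ).1 φ hφ).trans hc) ?_ (hstr.derivable hψ) hψα
  intro r hr ρ ρ' hρ hc hneg hρ' hq hp hn
  refine hstr.instConc_mem_transRel hr hρ' hp hq fun φ hφ π hπ => ?_
  obtain ⟨w, hw, φ₀, hφ₀, hφφ, hw₀⟩ := hn φ hφ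
  obtain ⟨w', hw'l, hw'r⟩ := BisimPair.exists_swap w
  rw [hw, ← hw'l] at hπ
  obtain ⟨π', hπ'⟩ := hα w' φ.2 π hπ
  rw [hw'r, ← hw₀, ← hφφ] at hπ'
  exact hneg φ₀ hφ₀ π' (hπ' (((hstr r hr ρ hρ).2 φ₀ hφ₀ π').trans_le hc))

/-- Nothing is to be shown for right conclusions in stratum `α` or beyond. For the others, a
transition that denies a negative premise lies in a stratum below `α`, and the hypothesis for that
stratum transports it back to the left. -/
theorem IsStratification.matchesBeyond (hstr : IsStratification P str) (hP : InFormat P)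
    {α : Ordinal} (hα : ∀ β < α, MatchesUpTo (transRel P str) str β) :
    MatchesBeyond (transRel P str) str α := by
  intro w a π hπ
  have htransfer : ∃ D σ, IsTransfer BisimPair.left (BisimPair.right (T := transRel P str))
      {ψ | str ψ < α → ψ ∈ transRel P str} (w.subst BisimPair.left, a, π) D σ := by
    refine Derivable.exists_isTransfer (G := fun _ => True)
      (T' := {ψ | str ψ < α → ψ ∈ transRel P str}) hP
      (fun _ => hstr.mem_of_derivable) (fun ψ hψ _ => hψ) (fun _ _ _ _ _ _ _ => trivial) ?_
      (hstr.derivable hπ) trivial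
    intro r hr ρ ρ' hρ _ hneg hρ' hq hp hn hc
    refine hstr.instConc_mem_transRel hr hρ'
      (fun φ hφ => hp φ hφ (((hstr r hr ρ' hρ').1 φ hφ).trans_lt hc)) hq fun φ hφ π hπ => ?_
    obtain ⟨w, hw, φ₀, hφ₀, hφφ, hw₀⟩ := hn φ hφ
    obtain ⟨w', hw'l, hw'r⟩ := BisimPair.exists_swap w
    have hlt := ((hstr r hr ρ' hρ').2 φ hφ π).trans hc
    rw [hw, ← hw'l] at hπ hlt
    obtain ⟨π', hπ'⟩ := hα _ hlt w' φ.2 π hπ le_rfl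
    rw [hw'r, ← hw₀, ← hφφ] at hπ'
    exact hneg φ₀ hφ₀ π' hπ'
  obtain ⟨D, σ, hD⟩ := htransfer
  exact ⟨_, hD.right_mem w rfl⟩

theorem IsStratification.matchesUpTo (hstr : IsStratification P str) (hP : InFormat P)
    (α : Ordinal) : MatchesUpTo (transRel P str) str α := by
  induction α using WellFoundedLT.induction with
  | ind α ih =>
    intro w a π hπ hα
    obtain ⟨D, σ, hD⟩ := hstr.exists_isTransfer hP (hstr.matchesBeyond hP ih) hπ hα
    exact ⟨_, hD.right_mem w rfl⟩

/-- The closure of bisimilarity under the operators is a bisimulation. -/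
theorem IsStratification.isBisimulation_instances (hstr : IsStratification P str)
    (hP : InFormat P) : IsBisimulation (transRel P str) fun t t' =>
      ∃ w : Term S (BisimPair (transRel P str)),
        w.subst BisimPair.left = t ∧ w.subst BisimPair.right = t' := by
  refine ⟨?_, ?_⟩
  · rintro t t' ⟨w, rfl, rfl⟩
    exact BisimPair.exists_swap w
  · rintro t t' ⟨w, rfl, rfl⟩ a π hπ
    obtain ⟨D, σ, hD⟩ := hstr.exists_isTransfer hP
      (hstr.matchesBeyond hP fun β _ => hstr.matchesUpTo hP β) hπ le_rfl
    refine ⟨_, hD.right_mem w rfl, fun Q hQ => ?_⟩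
    have hl : (D w).map (Term.subst BisimPair.left) = π := hD.left w rfl
    -- Both targets are images of `D w`, and a closed set contains the left instance of a marked
    -- term exactly if it contains the right one.
    rw [← hl, mass_map, mass_map]
    congr 1
    ext w'
    exact ⟨fun h => hQ _ h _ ⟨w', rfl, rfl⟩, fun h => hQ _ h _ (BisimPair.exists_swap w')⟩

end Congruence

theorem mainTheorem1 {S : Signature} {A V DV : Type*} [Infinite V] [Infinite DV]
    (P : PTSS S A V DV) (hP : InFormat P)
    (str : PTrn S A → Ordinal) (hstr : IsStratification P str) :
    IsCongruence (Bisimilar (transRel P str)) := by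
  refine ⟨bisimilar_equivalence _, fun f u v huv => ⟨_, hstr.isBisimulation_instances hP, ?_⟩⟩
  exact ⟨Term.app f fun i => Term.var ⟨(u i, v i), huv i⟩, rfl, rfl⟩
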